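/- Let $G$ be a discrete group, $A$ a $C^*$-algebra, $n\in\mathbb{N}$, and let $\alpha=((A_g)_{g\in G},(\alpha_g)_{g\in G})$ be a partial action of $G$ on $A$: closed two-sided ideals $A_g$ and $*$-isomorphisms $\alpha_g\colon A_{g^{-1}}\to A_g$ with $A_1=A$, $\alpha_1=\mathrm{id}$, and $\alpha_{gh}$ extending $\alpha_g\circ\alpha_h$. Put $\mathcal{T}_n(G)=\{\tau\subseteq G: 1\in\tau,\ |\tau|=n\}$ and $A_\tau=\bigcap_{g\in\tau}A_g$, and assume that $\alpha$ has the $n$-decomposition property: $A=\overline{\sum_{\tau\in\mathcal{T}_n(G)}A_\tau}$, and $A_\tau\cap A_g=\{0\}$ whenever $\tau\in\mathcal{T}_n(G)$ and $g\in G\setminus\tau$. Let $G$ act partially on $\mathcal{T}_n(G)$ by left multiplication ($g$ acts on the $\tau$ with $g^{-1}\in\tau$ by $\tau\mapsto g\tau$), with orbit space $\mathcal{O}_n(G)$. For $\tau\in\mathcal{T}_n(G)$ put $A_{G\cdot\tau}=\sum_{g\in\tau^{-1}}A_{g\tau}$, $H_\tau=\{h\in G: h\tau=\tau\}$ and $m_\tau=\frac{n}{|H_\tau|}-1$.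 Crossed products are full, with canonical elements $a\delta_g$ ($a$ in the domain ideal of $g$); in $A_\tau\rtimes_{\alpha|_{H_\tau}} H_\tau$ the element $a\delta_h$ is also written $a v_h$, where $v$ is the canonical unitary representation of $H_\tau$ in the multiplier algebra. (1) For every $\tau\in\mathcal{T}_n(G)$ there are elements $x_0=1,x_1,\dots,x_{m_\tau}\in G$ with $\tau=\bigsqcup_{j=0}^{m_\tau}H_\tau x_j$, and for every choice of such elements there is a unique $*$-isomorphism \[\psi_\tau\colon A_{G\cdot\tau}\rtimes_\alpha G\to M_{m_\tau+1}(A_\tau\rtimes_{\alpha|_{H_\tau}}H_\tau)\] satisfying $\psi_\tau(a\delta_{x_j^{-1}hx_k})=\alpha_{x_j}(a)v_h\otimes e_{j,k}$ for all $j,k\in\{0,\dots,m_\tau\}$, $h\in H_\tau$ and $a\in A_{x_j^{-1}\tau}$. (2) Consequently, for every section $z\mapsto\tau_z$ of the quotient map $\mathcal{T}_n(G)\to\mathcal{O}_n(G)$ and every choice of elements $x_j^{z}$ as in (1) for each $\tau_z$, there is a unique $*$-isomorphism \[\Psi\colon A\rtimes_\alpha G\to\bigoplus_{z\in\mathcal{O}_n(G)}M_{m_{\tau_z}+1}(A_{\tau_z}\rtimes_{\alpha|_{H_{\tau_z}}}H_{\tau_z})\]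 onto the $C^*$-algebraic ($c_0$-) direct sum which, for all $z$, $j,k\in\{0,\dots,m_{\tau_z}\}$, $h\in H_{\tau_z}$ and $a\in A_{(x_j^{z})^{-1}\tau_z}$, sends $a\delta_{(x_j^{z})^{-1}hx_k^{z}}$ to the element whose component in the summand $z$ is $\alpha_{x_j^{z}}(a)v_h\otimes e_{j,k}$ and whose other components are $0$. -/

import Mathlib

noncomputable section

open Filter Topology
open scoped Pointwise ENNReal DirectSum

namespace PartialCrossed

universe u v

/-! ### Hausdorff completion of a `*`-algebra with respect to a `C^*`-seminorm -/

/-- A complex `*`-algebra (non-unital) together with a `C^*`-seminorm `‖·‖`. -/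
class PreCStarAlgebra (V : Type u) extends NonUnitalSeminormedRing V, StarRing V,
    NormedSpace ℂ V, IsScalarTower ℂ V V, SMulCommClass ℂ V V, StarModule ℂ V where
  norm_star_mul_self' : ∀ x : V, ‖star x * x‖ = ‖x‖ ^ 2

namespace PreCStarAlgebra

open UniformSpace UniformSpace.Completion

variable (V : Type u) [PreCStarAlgebra V]

variable {V} in
theorem norm_star' (x : V) : ‖star x‖ = ‖x‖ := by
  have key : ∀ y : V, ‖y‖ ≤ ‖star y‖ := fun y => by
    rcases (norm_nonneg y).eq_or_lt with h | h
    · rw [← h]; exact norm_nonneg _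
    · have h1 : ‖y‖ ^ 2 ≤ ‖star y‖ * ‖y‖ := by
        rw [← norm_star_mul_self']; exact norm_mul_le _ _
      nlinarith
  refine le_antisymm ?_ (key x)
  simpa using key (star x)

/-- The `C^*`-algebra obtained as the Hausdorff completion of a `*`-algebra with respect to a
`C^*`-seminorm. -/
def Compl : Type u := Completion V

instance : NormedAddCommGroup (Compl V) := inferInstanceAs (NormedAddCommGroup (Completion V))
instance : NormedSpace ℂ (Compl V) := inferInstanceAs (NormedSpace ℂ (Completion V))
instance : CompleteSpace (Compl V) := inferInstanceAs (CompleteSpace (Completion V))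

variable {V}

/-- The canonical map from a `*`-algebra to its completion. -/
def toC (x : V) : Compl V := ((x : Completion V) : Completion V)

theorem continuous_csmul (c : ℂ) : Continuous fun a : Compl V => c • a :=
  continuous_const_smul c

theorem toC_add (x y : V) : toC (x + y) = toC x + toC y := Completion.coe_add x y
theorem toC_zero : toC (0 : V) = 0 := rfl
theorem toC_smul (c : ℂ) (x : V) : toC (c • x) = c • toC x := Completion.coe_smul c x
theorem norm_toC (x : V) : ‖toC x‖ = ‖x‖ := Completion.norm_coe x
theorem continuous_toC : Continuous (toC : V → Compl V) := Completion.continuous_coe V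
theorem denseRange_toC : DenseRange (toC : V → Compl V) := Completion.denseRange_coe
theorem isDenseInducing_toC : IsDenseInducing (toC : V → Compl V) :=
  Completion.isDenseInducing_coe

theorem ind₁ {p : Compl V → Prop} (hp : IsClosed {a | p a}) (h : ∀ x : V, p (toC x))
    (a : Compl V) : p a := Completion.induction_on a hp h

theorem ind₂ {p : Compl V → Compl V → Prop} (hp : IsClosed {a : Compl V × Compl V | p a.1 a.2})
    (h : ∀ x y : V, p (toC x) (toC y)) (a b : Compl V) : p a b :=
  Completion.induction_on₂ a b hp h

theorem ind₃ {p : Compl V → Compl V → Compl V → Prop}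
    (hp : IsClosed {a : Compl V × Compl V × Compl V | p a.1 a.2.1 a.2.2})
    (h : ∀ x y z : V, p (toC x) (toC y) (toC z)) (a b c : Compl V) : p a b c :=
  Completion.induction_on₃ a b c hp h

instance : Mul (Compl V) :=
  ⟨Function.curry <| (isDenseInducing_toC.prodMap isDenseInducing_toC).extend
    (toC ∘ Function.uncurry ((· * ·) : V → V → V))⟩

theorem toC_mul (x y : V) : toC (x * y) = toC x * toC y :=
  ((isDenseInducing_toC.prodMap isDenseInducing_toC).extend_eq
    (continuous_toC.comp (@continuous_mul V _ _ _)) (x, y)).symm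

/-- `toC` as an additive homomorphism. -/
def toCHom : V →+ Compl V where
  toFun := toC
  map_zero' := toC_zero
  map_add' := toC_add

instance : ContinuousMul (Compl V) where
  continuous_mul := by
    let m := (AddMonoidHom.mul : V →+ V →+ V).compr₂ toCHom
    have : Continuous fun p : V × V => m p.1 p.2 := continuous_toC.comp continuous_mul
    have di : IsDenseInducing (toCHom : V → Compl V) := isDenseInducing_toC
    exact (di.extend_Z_bilin di this :)

instance : NonUnitalRing (Compl V) :=
  { (inferInstance : AddCommGroup (Compl V)), (inferInstance : Mul (Compl V)) with
    zero_mul := ind₁ (isClosed_eq (by fun_prop) (by fun_prop)) fun a => by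
      rw [← toC_zero, ← toC_mul, zero_mul]
    mul_zero := ind₁ (isClosed_eq (by fun_prop) (by fun_prop)) fun a => by
      rw [← toC_zero, ← toC_mul, mul_zero]
    mul_assoc := ind₃ (isClosed_eq (by fun_prop) (by fun_prop)) fun a b c => by
      simp only [← toC_mul, mul_assoc]
    left_distrib := ind₃ (isClosed_eq (by fun_prop) (by fun_prop)) fun a b c => by
      simp only [← toC_mul, ← toC_add, mul_add]
    right_distrib := ind₃ (isClosed_eq (by fun_prop) (by fun_prop)) fun a b c => by
      simp only [← toC_mul, ← toC_add, add_mul] }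

instance : Star (Compl V) := ⟨Completion.map (star : V → V)⟩

theorem star_dist (x y : V) : dist (star x) (star y) = dist x y := by
  rw [dist_eq_norm, dist_eq_norm, ← star_sub, norm_star']

theorem toC_star (x : V) : toC (star x) = star (toC x) :=
  (Completion.map_coe (Isometry.of_dist_eq star_dist).uniformContinuous x).symm

theorem continuous_star' : Continuous (star : Compl V → Compl V) := Completion.continuous_map

instance : ContinuousStar (Compl V) := ⟨continuous_star'⟩

instance : StarRing (Compl V) where
  star_involutive := ind₁ (isClosed_eq (by fun_prop) (by fun_prop)) fun a => by
      simp only [← toC_star, star_star]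
  star_mul := ind₂ (isClosed_eq (by fun_prop) (by fun_prop)) fun a b => by
      simp only [← toC_star, ← toC_mul, star_mul]
  star_add := ind₂ (isClosed_eq (by fun_prop) (by fun_prop)) fun a b => by
      simp only [← toC_star, ← toC_add, star_add]

instance : NonUnitalNormedRing (Compl V) :=
  { (inferInstance : NormedAddCommGroup (Compl V)),
    (inferInstance : NonUnitalRing (Compl V)) with
    norm_mul_le := ind₂ (isClosed_le (by fun_prop) (by fun_prop)) fun a b => by
      simp only [← toC_mul, norm_toC]; exact norm_mul_le a b }

instance : CStarRing (Compl V) where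
  norm_mul_self_le := ind₁ (isClosed_le (by fun_prop) (by fun_prop)) fun a => by
      rw [← toC_star, ← toC_mul, norm_toC, norm_toC, norm_star_mul_self', sq]

instance : IsScalarTower ℂ (Compl V) (Compl V) where
  smul_assoc c := ind₂ (p := fun a b => c • a * b = c • (a * b))
    (isClosed_eq (((continuous_csmul c).comp continuous_fst).mul continuous_snd)
      ((continuous_csmul c).comp continuous_mul)) fun a b => by
      rw [← toC_smul, ← toC_mul, ← toC_mul, ← toC_smul, smul_mul_assoc]

instance : SMulCommClass ℂ (Compl V) (Compl V) where
  smul_comm c := ind₂ (p := fun a b => c • (a * b) = a * c • b)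
    (isClosed_eq ((continuous_csmul c).comp continuous_mul)
      (continuous_fst.mul ((continuous_csmul c).comp continuous_snd))) fun a b => by
      rw [← toC_smul, ← toC_mul, ← toC_mul, ← toC_smul, mul_smul_comm]

instance : StarModule ℂ (Compl V) where
  star_smul c := ind₁ (p := fun a => star (c • a) = star c • star a)
    (isClosed_eq (continuous_star'.comp (continuous_csmul c))
      ((continuous_csmul (star c)).comp continuous_star')) fun a => by
      rw [← toC_star, ← toC_smul, ← toC_smul, ← toC_star, star_smul]

instance : NonUnitalCStarAlgebra (Compl V) where

end PreCStarAlgebra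

/-! ### Closed ideals -/

/-- Closed two-sided ideals of a `C^*`-algebra. (Self-adjointness is automatic for closed
two-sided ideals; it is recorded so that ideals are visibly `C^*`-algebras.) -/
structure ClosedIdeal (A : Type v) [NonUnitalCStarAlgebra A] extends Submodule ℂ A where
  isClosed' : IsClosed carrier
  mul_mem_left' : ∀ (x : A) {a : A}, a ∈ carrier → x * a ∈ carrier
  mul_mem_right' : ∀ (x : A) {a : A}, a ∈ carrier → a * x ∈ carrier
  star_mem' : ∀ {a : A}, a ∈ carrier → star a ∈ carrier

namespace ClosedIdeal

variable {A : Type v} [NonUnitalCStarAlgebra A]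

instance : SetLike (ClosedIdeal A) A where
  coe I := I.carrier
  coe_injective I J h := by
    rcases I with ⟨I, _⟩; rcases J with ⟨J, _⟩
    congr
    exact SetLike.coe_injective h

instance : NonUnitalSubringClass (ClosedIdeal A) A where
  add_mem {I} _ _ ha hb := I.add_mem' ha hb
  zero_mem I := I.zero_mem'
  neg_mem {I} _ ha := I.toSubmodule.neg_mem ha
  mul_mem {I} a _ _ hb := I.mul_mem_left' a hb

instance : SMulMemClass (ClosedIdeal A) ℂ A where
  smul_mem {I} c _ ha := I.smul_mem' c ha

instance : StarMemClass (ClosedIdeal A) A where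
  star_mem {I} _ ha := I.star_mem' ha

theorem isClosed (I : ClosedIdeal A) : IsClosed (I : Set A) := I.isClosed'

theorem mul_left_mem (I : ClosedIdeal A) (x : A) {a : A} (h : a ∈ I) : x * a ∈ I :=
  I.mul_mem_left' x h

theorem mul_right_mem (I : ClosedIdeal A) (x : A) {a : A} (h : a ∈ I) : a * x ∈ I :=
  I.mul_mem_right' x h

/-- A closed ideal is itself a `C^*`-algebra. -/
instance (I : ClosedIdeal A) : NonUnitalCStarAlgebra I :=
  NonUnitalStarSubalgebra.nonUnitalCStarAlgebra I (h_closed := I.isClosed)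

/-- `a * x`, as an element of the ideal containing `a`. -/
def mulr (I : ClosedIdeal A) (a : I) (x : A) : I := ⟨a * x, I.mul_right_mem x a.2⟩

/-- The closure of the algebraic sum `∑ i, I i` of a family of closed ideals. For a finite family
the algebraic sum is already closed. -/
def closedSum {ι : Type*} (I : ι → ClosedIdeal A) : ClosedIdeal A where
  toSubmodule := (⨆ i, (I i).toSubmodule).topologicalClosure
  isClosed' := Submodule.isClosed_topologicalClosure _
  mul_mem_left' x a ha := by
    refine map_mem_closure (f := fun y => x * y) (by fun_prop) ha fun b hb => ?_
    refine Submodule.iSup_induction (fun i => (I i).toSubmodule)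
      (motive := fun b => x * b ∈ (⨆ i, (I i).toSubmodule : Submodule ℂ A)) hb ?_ ?_ ?_
    · exact fun i y hy => Submodule.mem_iSup_of_mem i ((I i).mul_left_mem x hy)
    · simp
    · intro y z hy hz; rw [mul_add]; exact add_mem hy hz
  mul_mem_right' x a ha := by
    refine map_mem_closure (f := fun y => y * x) (by fun_prop) ha fun b hb => ?_
    refine Submodule.iSup_induction (fun i => (I i).toSubmodule)
      (motive := fun b => b * x ∈ (⨆ i, (I i).toSubmodule : Submodule ℂ A)) hb ?_ ?_ ?_
    · exact fun i y hy => Submodule.mem_iSup_of_mem i ((I i).mul_right_mem x hy)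
    · simp
    · intro y z hy hz; rw [add_mul]; exact add_mem hy hz
  star_mem' {a} ha := by
    refine map_mem_closure (f := fun y => star y) (by fun_prop) ha fun b hb => ?_
    refine Submodule.iSup_induction (fun i => (I i).toSubmodule)
      (motive := fun b => star b ∈ (⨆ i, (I i).toSubmodule : Submodule ℂ A)) hb ?_ ?_ ?_
    · exact fun i y hy => Submodule.mem_iSup_of_mem i ((I i).star_mem' hy)
    · simp
    · intro y z hy hz; rw [star_add]; exact add_mem hy hz

theorem mem_closedSum {ι : Type*} {I : ι → ClosedIdeal A} (i : ι) {a : A} (h : a ∈ I i) :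
    a ∈ closedSum I :=
  subset_closure (Submodule.mem_iSup_of_mem (p := fun i => (I i).toSubmodule) i h)

/-- Intersection of two closed ideals. -/
def inf (I J : ClosedIdeal A) : ClosedIdeal A where
  toSubmodule := I.toSubmodule ⊓ J.toSubmodule
  isClosed' := I.isClosed.inter J.isClosed
  mul_mem_left' x _ ha := ⟨I.mul_left_mem x ha.1, J.mul_left_mem x ha.2⟩
  mul_mem_right' x _ ha := ⟨I.mul_right_mem x ha.1, J.mul_right_mem x ha.2⟩
  star_mem' ha := ⟨I.star_mem' ha.1, J.star_mem' ha.2⟩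

theorem mem_inf {I J : ClosedIdeal A} {a : A} : a ∈ I.inf J ↔ a ∈ I ∧ a ∈ J := Iff.rfl

/-- Existence of approximate units, in the form of a filter. -/
theorem exists_approxUnit (B : Type v) [NonUnitalCStarAlgebra B] :
    ∃ l : Filter B, l.NeBot ∧ ∀ a : B, Tendsto (fun u => a * u) l (𝓝 a) := by
  let _ := CStarAlgebra.spectralOrder B
  let _ := CStarAlgebra.spectralOrderedRing B
  have h := CStarAlgebra.increasingApproximateUnit B
  exact ⟨CStarAlgebra.approximateUnit B, h.neBot, h.tendsto_mul_left⟩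

end ClosedIdeal

/-! ### Partial actions -/

/-- A partial action of a discrete group `G` on a `C^*`-algebra `A`: closed two-sided ideals
`A_g = D g` and `*`-isomorphisms `α_g = act g : A_{g⁻¹} → A_g` such that `A_1 = A`, `α_1 = id`, and
`α_{gh}` extends `α_g ∘ α_h`, the latter being defined on `{a ∈ A_{h⁻¹} | α_h(a) ∈ A_{g⁻¹}}`. -/
structure PartialAction (G : Type u) [Group G] (A : Type v) [NonUnitalCStarAlgebra A] where
  D : G → ClosedIdeal A
  act : ∀ g : G, D g⁻¹ ≃⋆ₐ[ℂ] D g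
  D_one : ∀ a : A, a ∈ D 1
  act_one : ∀ a : D 1⁻¹, (act 1 a : A) = a
  act_mul : ∀ (g h : G) (a : D h⁻¹) (ha : (act h a : A) ∈ D g⁻¹),
    ∃ ha' : (a : A) ∈ D (g * h)⁻¹, (act (g * h) ⟨a, ha'⟩ : A) = act g ⟨act h a, ha⟩

namespace PartialAction

variable {G : Type u} [Group G] {A : Type v} [NonUnitalCStarAlgebra A] (α : PartialAction G A)

/-- The graph of `α_g`: `a ∈ A_{g⁻¹}` and `α_g(a) = b`. -/
def Maps (g : G) (a b : A) : Prop := ∃ h : a ∈ α.D g⁻¹, (α.act g ⟨a, h⟩ : A) = b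

variable {α}

theorem maps_act (g : G) (a : α.D g⁻¹) : α.Maps g a (α.act g a) := ⟨a.2, rfl⟩

theorem maps_symm (g : G) (b : α.D g) : α.Maps g ((α.act g).symm b) b := ⟨Subtype.prop _, by simp⟩

theorem Maps.mem_left {g : G} {a b : A} (h : α.Maps g a b) : a ∈ α.D g⁻¹ := h.1

theorem Maps.mem_right {g : G} {a b : A} (h : α.Maps g a b) : b ∈ α.D g := by
  obtain ⟨h, rfl⟩ := h; exact Subtype.prop _

theorem Maps.unique {g : G} {a b c : A} (h : α.Maps g a b) (h' : α.Maps g a c) : b = c := by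
  obtain ⟨h, rfl⟩ := h; obtain ⟨h', rfl⟩ := h'; rfl

theorem maps_of_mem {g : G} {a : A} (h : a ∈ α.D g⁻¹) : ∃ b, α.Maps g a b := ⟨_, h, rfl⟩

theorem Maps.comp {g h : G} {a b c : A} (h1 : α.Maps h a b) (h2 : α.Maps g b c) :
    α.Maps (g * h) a c := by
  obtain ⟨h1, rfl⟩ := h1; obtain ⟨h2, rfl⟩ := h2
  exact α.act_mul g h ⟨a, h1⟩ h2

theorem Maps.one {a b : A} (h : α.Maps 1 a b) : b = a := by
  obtain ⟨h, rfl⟩ := h; exact α.act_one _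

theorem maps_one (a : A) : α.Maps 1 a a := by
  have : a ∈ α.D (1 : G)⁻¹ := by rw [inv_one]; exact α.D_one a
  exact ⟨this, α.act_one ⟨a, this⟩⟩

theorem Maps.inv {g : G} {a b : A} (h : α.Maps g a b) : α.Maps g⁻¹ b a := by
  have hb : b ∈ α.D g⁻¹⁻¹ := by rw [inv_inv]; exact h.mem_right
  obtain ⟨c, hc⟩ := maps_of_mem hb
  have := h.comp hc
  rw [inv_mul_cancel] at this
  rw [← this.one]; exact hc

theorem maps_inv_iff {g : G} {a b : A} : α.Maps g⁻¹ b a ↔ α.Maps g a b :=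
  ⟨fun h => by simpa using h.inv, fun h => h.inv⟩

theorem Maps.unique_left {g : G} {a b c : A} (h : α.Maps g a c) (h' : α.Maps g b c) : a = b :=
  h.inv.unique h'.inv

theorem Maps.symm_eq {g : G} {a : A} {b : α.D g} (h : α.Maps g a b) :
    ((α.act g).symm b : A) = a := (maps_symm g b).unique_left h

theorem Maps.add {g : G} {a b a' b' : A} (h : α.Maps g a b) (h' : α.Maps g a' b') :
    α.Maps g (a + a') (b + b') := by
  obtain ⟨h, rfl⟩ := h; obtain ⟨h', rfl⟩ := h'
  exact ⟨add_mem h h', congrArg Subtype.val (map_add (α.act g) ⟨a, h⟩ ⟨a', h'⟩)⟩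

theorem Maps.mul {g : G} {a b a' b' : A} (h : α.Maps g a b) (h' : α.Maps g a' b') :
    α.Maps g (a * a') (b * b') := by
  obtain ⟨h, rfl⟩ := h; obtain ⟨h', rfl⟩ := h'
  exact ⟨mul_mem h h', congrArg Subtype.val (map_mul (α.act g) ⟨a, h⟩ ⟨a', h'⟩)⟩

theorem Maps.smul {g : G} {a b : A} (c : ℂ) (h : α.Maps g a b) :
    α.Maps g (c • a) (c • b) := by
  obtain ⟨h, rfl⟩ := h
  exact ⟨SMulMemClass.smul_mem c h, congrArg Subtype.val (map_smul (α.act g) c ⟨a, h⟩)⟩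

theorem Maps.star {g : G} {a b : A} (h : α.Maps g a b) : α.Maps g (star a) (star b) := by
  obtain ⟨h, rfl⟩ := h
  exact ⟨star_mem h, congrArg Subtype.val (map_star (α.act g) ⟨a, h⟩)⟩

theorem maps_zero (g : G) : α.Maps g 0 0 :=
  ⟨zero_mem _, congrArg Subtype.val (map_zero (α.act g))⟩

/-- `α_g` maps `A_{g⁻¹} ∩ A_h` into `A_{gh}`. -/
theorem Maps.mem_mul {g h : G} {a b : A} (hab : α.Maps g a b) (ha : a ∈ α.D h) :
    b ∈ α.D (g * h) :=
  ((maps_symm h ⟨a, ha⟩).comp hab).mem_right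

theorem continuous_act (g : G) : Continuous (α.act g) :=
  (NonUnitalStarAlgHom.isometry (α.act g) (α.act g).injective).continuous

theorem continuous_act_symm (g : G) : Continuous (α.act g).symm :=
  (NonUnitalStarAlgHom.isometry (α.act g).symm (α.act g).symm.injective).continuous

/-- The twisted product `α_g(α_g⁻¹(a) b) ∈ A_g ∩ A_{gh}` for `a ∈ A_g`, `b ∈ A`. -/
def tw (α : PartialAction G A) (g : G) (a : α.D g) (b : A) : α.D g :=
  α.act g ((α.D g⁻¹).mulr ((α.act g).symm a) b)

theorem maps_tw (g : G) (a : α.D g) (b : A) :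
    α.Maps g ((α.act g).symm a * b) (α.tw g a b) :=
  maps_act g ((α.D g⁻¹).mulr ((α.act g).symm a) b)

theorem tw_mem (g h : G) (a : α.D g) {b : A} (hb : b ∈ α.D h) : (α.tw g a b : A) ∈ α.D (g * h) :=
  (maps_tw g a b).mem_mul ((α.D h).mul_left_mem _ hb)

/-- The identity behind associativity of the crossed product. -/
theorem mul_tw (h : G) (x : A) (b : α.D h) (c : A) :
    (α.tw h ⟨x * b, (α.D h).mul_left_mem x b.2⟩ c : A) = x * α.tw h b c := by
  obtain ⟨l, hl, hlim⟩ := ClosedIdeal.exists_approxUnit (α.D h⁻¹)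
  set xb : α.D h := ⟨x * b, (α.D h).mul_left_mem x b.2⟩ with hxb
  have key : ∀ (y : α.D h), Tendsto (fun u : α.D h⁻¹ =>
      ((α.act h ((α.D h⁻¹).mulr ((α.act h).symm y * u) c) : α.D h) : A)) l (𝓝 (α.tw h y c : A)) := by
    intro y
    have hc : Continuous fun v : α.D h⁻¹ => ((α.act h ((α.D h⁻¹).mulr v c) : α.D h) : A) := by
      refine continuous_subtype_val.comp ((continuous_act h).comp ?_)
      exact Continuous.subtype_mk (continuous_subtype_val.mul continuous_const) _
    exact (hc.tendsto _).comp (hlim ((α.act h).symm y))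
  have e : ∀ (y : α.D h) (u : α.D h⁻¹),
      ((α.act h ((α.D h⁻¹).mulr ((α.act h).symm y * u) c) : α.D h) : A)
        = y * (α.act h ((α.D h⁻¹).mulr u c) : α.D h) := by
    intro y u
    have h1 := (maps_symm h y).mul (maps_act h ((α.D h⁻¹).mulr u c))
    refine Maps.unique (maps_act h _) ?_
    convert h1 using 1
    exact mul_assoc _ _ _
  refine tendsto_nhds_unique (key xb) ?_
  have h2 := (key b).const_mul x
  refine h2.congr fun u => ?_
  rw [e, e, hxb, mul_assoc]

/-! ### The algebraic crossed product -/

variable (α)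

/-- The algebraic crossed product: finitely supported formal sums `∑ a_g δ_g`, `a_g ∈ A_g`. -/
def AlgCrossed : Type (max u v) := Π₀ g, α.D g

namespace AlgCrossed

instance : AddCommGroup α.AlgCrossed := inferInstanceAs (AddCommGroup (Π₀ g, α.D g))
instance : Module ℂ α.AlgCrossed := inferInstanceAs (Module ℂ (Π₀ g, α.D g))

open Classical in
/-- The element `a δ_g`, for `a ∈ A_g`. -/
def dl (g : G) : α.D g →+ α.AlgCrossed := DFinsupp.singleAddHom (fun g => (α.D g : Type v)) g

open Classical in
/-- The additive map determined by its values on the elements `a δ_g`. -/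
def lift {M : Type*} [AddCommMonoid M] (f : ∀ g, α.D g →+ M) : α.AlgCrossed →+ M :=
  DFinsupp.liftAddHom f

variable {α}

theorem lift_dl {M : Type*} [AddCommMonoid M] (f : ∀ g, α.D g →+ M) (g : G) (a : α.D g) :
    lift α f (dl α g a) = f g a := by
  classical
  exact DFinsupp.liftAddHom_apply_single f g a

theorem ind {p : α.AlgCrossed → Prop} (x : α.AlgCrossed) (zero : p 0)
    (of : ∀ g a, p (dl α g a)) (add : ∀ x y, p x → p y → p (x + y)) : p x := by
  classical
  exact DirectSum.induction_on (β := fun g => α.D g) x zero of add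

theorem dl_congr {g g' : G} {a : α.D g} {a' : α.D g'} (hg : g = g') (h : (a : A) = a') :
    dl α g a = dl α g' a' := by
  subst hg; rw [Subtype.ext h]

theorem smul_dl (c : ℂ) (g : G) (a : α.D g) : c • dl α g a = dl α g (c • a) := by
  classical
  exact (DFinsupp.single_smul (β := fun g => α.D g) c a).symm

variable (α)

/-- The product `(a δ_g)(b δ_h) = α_g(α_g⁻¹(a) b) δ_{gh}`. -/
def mulHom : α.AlgCrossed →+ α.AlgCrossed →+ α.AlgCrossed :=
  lift α fun g => AddMonoidHom.mk'
    (fun a => lift α fun h => AddMonoidHom.mk'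
      (fun b => dl α (g * h) ⟨α.tw g a b, tw_mem g h a b.2⟩) fun b b' => by
        rw [← map_add]
        refine dl_congr rfl ((maps_tw g a _).unique ?_)
        have := (maps_tw g a (b : A)).add (maps_tw g a (b' : A))
        rwa [← mul_add] at this) fun a a' => by
        ext x
        induction x using ind with
        | zero => simp
        | add x x' hx hx' => simp only [map_add, hx, hx']
        | of h b =>
        simp only [AddMonoidHom.add_apply, lift_dl, AddMonoidHom.mk'_apply]
        rw [← map_add]
        refine dl_congr rfl ((maps_tw g _ _).unique ?_)
        have := (maps_tw g a (b : A)).add (maps_tw g a' (b : A))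
        rw [← add_mul] at this
        rwa [map_add]

instance : Mul α.AlgCrossed := ⟨fun x y => mulHom α x y⟩

/-- The involution `(a δ_g)^* = α_g⁻¹(a^*) δ_{g⁻¹}`. -/
def starHom : α.AlgCrossed →+ α.AlgCrossed :=
  lift α fun g => AddMonoidHom.mk' (fun a => dl α g⁻¹ ((α.act g).symm (star a))) fun a b => by
    rw [← map_add, star_add, map_add]

instance : Star α.AlgCrossed := ⟨starHom α⟩

variable {α}

theorem mul_def (x y : α.AlgCrossed) : x * y = mulHom α x y := rfl

theorem dl_mul_dl (g h : G) (a : α.D g) (b : α.D h) :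
    dl α g a * dl α h b = dl α (g * h) ⟨α.tw g a b, tw_mem g h a b.2⟩ := by
  simp only [mul_def, mulHom, lift_dl, AddMonoidHom.mk'_apply]

theorem star_dl (g : G) (a : α.D g) :
    star (dl α g a) = dl α g⁻¹ ((α.act g).symm (star a)) := by
  change starHom α _ = _
  simp only [starHom, lift_dl, AddMonoidHom.mk'_apply]

theorem mul_add' (x y z : α.AlgCrossed) : x * (y + z) = x * y + x * z := by
  simp only [mul_def, map_add]

theorem add_mul' (x y z : α.AlgCrossed) : (x + y) * z = x * z + y * z := by
  simp only [mul_def, map_add, AddMonoidHom.add_apply]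

theorem zero_mul' (x : α.AlgCrossed) : 0 * x = 0 := by
  simp only [mul_def, map_zero, AddMonoidHom.zero_apply]

theorem mul_zero' (x : α.AlgCrossed) : x * 0 = 0 := by
  simp only [mul_def, map_zero]

theorem mul_assoc' (x y z : α.AlgCrossed) : x * y * z = x * (y * z) := by
  induction x using ind with
  | zero => simp only [zero_mul']
  | add x x' hx hx' => simp only [add_mul', hx, hx']
  | of g a =>
  induction y using ind with
  | zero => simp only [zero_mul', mul_zero']
  | add x x' hx hx' => simp only [add_mul', mul_add', hx, hx']
  | of h b =>
  induction z using ind with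
  | zero => simp only [mul_zero']
  | add x x' hx hx' => simp only [mul_add', hx, hx']
  | of k c =>
  simp only [dl_mul_dl]
  refine dl_congr (mul_assoc g h k) ?_
  set a' : A := ((α.act g).symm a : A) with ha'
  set xb : α.D h := ⟨a' * b, (α.D h).mul_left_mem a' b.2⟩ with hxb
  have h3 := mul_tw h a' b (c : A)
  have h1 := maps_tw g a ((α.tw h b c : A))
  rw [← h3] at h1
  have h2 := (maps_tw h xb (c : A)).comp h1
  have h4 := maps_tw (α := α) (g * h) ⟨α.tw g a (b : A), tw_mem g h a b.2⟩ (c : A)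
  have h5 : (((α.act (g * h)).symm ⟨α.tw g a b, tw_mem g h a b.2⟩ : α.D (g * h)⁻¹) : A)
      = (α.act h).symm xb := by
    refine Maps.symm_eq ((maps_symm h xb).comp ?_)
    exact maps_tw g a (b : A)
  rw [h5] at h4
  exact h4.unique h2

instance : NonUnitalRing α.AlgCrossed :=
  { (inferInstance : AddCommGroup α.AlgCrossed), (inferInstance : Mul α.AlgCrossed) with
    left_distrib := mul_add'
    right_distrib := add_mul'
    zero_mul := zero_mul'
    mul_zero := mul_zero'
    mul_assoc := mul_assoc' }

theorem star_add' (x y : α.AlgCrossed) : star (x + y) = star x + star y :=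
  map_add (starHom α) x y

theorem star_zero' : star (0 : α.AlgCrossed) = 0 := map_zero (starHom α)

instance : StarRing α.AlgCrossed where
  star_add := star_add'
  star_involutive x := by
    induction x using ind with
    | zero => simp only [star_zero']
    | add x x' hx hx' => simp only [star_add', hx, hx']
    | of g a =>
    rw [star_dl, star_dl]
    refine dl_congr (inv_inv g) (Maps.symm_eq ?_)
    have := (maps_symm g (star a)).star.inv
    rw [show (star ((star a : α.D g) : A)) = (a : A) from star_star _] at this
    exact this
  star_mul x y := by
    induction x using ind with
    | zero => simp only [star_zero', zero_mul, mul_zero]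
    | add x x' hx hx' => simp only [star_add', add_mul, mul_add, hx, hx']
    | of g a =>
    induction y using ind with
    | zero => simp only [star_zero', zero_mul, mul_zero]
    | add x x' hx hx' => simp only [star_add', add_mul, mul_add, hx, hx']
    | of h b =>
    rw [dl_mul_dl, star_dl, star_dl, star_dl, dl_mul_dl]
    refine dl_congr (mul_inv_rev g h) (Maps.symm_eq ?_)
    have h1 := maps_tw h⁻¹ ((α.act h).symm (star b)) (((α.act g).symm (star a) : α.D g⁻¹) : A)
    have h0 : (((α.act h⁻¹).symm ((α.act h).symm (star b)) : α.D h⁻¹⁻¹) : A) = star (b : A) :=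
      Maps.symm_eq (maps_symm h (star b)).inv
    rw [h0] at h1
    have h2 := (maps_tw g a (b : A)).star
    rw [star_mul] at h2
    have h3 : star (((α.act g).symm a : α.D g⁻¹) : A) = ((α.act g).symm (star a) : α.D g⁻¹) :=
      (Maps.symm_eq (maps_symm g a).star).symm
    rw [h3] at h2
    exact (maps_inv_iff.1 h1).comp h2

instance : IsScalarTower ℂ α.AlgCrossed α.AlgCrossed where
  smul_assoc c x y := by
    simp only [smul_eq_mul]
    induction x using ind with
    | zero => simp
    | add x x' hx hx' => simp only [smul_add, add_mul, hx, hx']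
    | of g a =>
    induction y using ind with
    | zero => simp
    | add x x' hx hx' => simp only [smul_add, mul_add, hx, hx']
    | of h b =>
    rw [smul_dl, dl_mul_dl, dl_mul_dl, smul_dl]
    refine dl_congr rfl ((maps_tw g _ _).unique ?_)
    have := (maps_tw g a (b : A)).smul c
    rw [← smul_mul_assoc] at this
    rwa [map_smul]

instance : SMulCommClass ℂ α.AlgCrossed α.AlgCrossed where
  smul_comm c x y := by
    simp only [smul_eq_mul]
    induction x using ind with
    | zero => simp
    | add x x' hx hx' => simp only [smul_add, add_mul, hx, hx']
    | of g a =>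
    induction y using ind with
    | zero => simp
    | add x x' hx hx' => simp only [smul_add, mul_add, hx, hx']
    | of h b =>
    rw [smul_dl, dl_mul_dl, dl_mul_dl, smul_dl]
    refine dl_congr rfl ((maps_tw g _ _).unique ?_).symm
    have := (maps_tw g a (b : A)).smul c
    rwa [← mul_smul_comm] at this

instance : StarModule ℂ α.AlgCrossed where
  star_smul c x := by
    induction x using ind with
    | zero => simp
    | add x x' hx hx' => simp only [smul_add, star_add, hx, hx']
    | of g a =>
    rw [smul_dl, star_dl, star_dl, smul_dl, star_smul, map_smul]

end AlgCrossed

/-! ### The full crossed product -/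

/-- A `C^*`-seminorm on the algebraic crossed product, dominated by the norm `∑ ‖a_g‖`. (The
domination is in fact automatic.) -/
structure CStarSeminorm extends Seminorm ℂ α.AlgCrossed where
  mul_le' : ∀ x y, toFun (x * y) ≤ toFun x * toFun y
  star_mul_self' : ∀ x, toFun (star x * x) = toFun x ^ 2
  dl_le' : ∀ g a, toFun (AlgCrossed.dl α g a) ≤ ‖a‖

namespace CStarSeminorm

instance : Inhabited α.CStarSeminorm :=
  ⟨{ (0 : Seminorm ℂ α.AlgCrossed) with
      mul_le' := fun _ _ => (mul_zero (0 : ℝ)).ge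
      star_mul_self' := fun _ => (zero_pow two_ne_zero).symm
      dl_le' := fun _ a => norm_nonneg a }⟩

variable {α}

theorem bddAbove (x : α.AlgCrossed) :
    BddAbove (Set.range fun p : α.CStarSeminorm => p.toSeminorm x) := by
  induction x using AlgCrossed.ind with
  | zero => exact ⟨0, by rintro _ ⟨p, rfl⟩; simp⟩
  | of g a => exact ⟨‖a‖, by rintro _ ⟨p, rfl⟩; exact p.dl_le' g a⟩
  | add x y hx hy =>
    obtain ⟨C, hC⟩ := hx
    obtain ⟨C', hC'⟩ := hy
    refine ⟨C + C', ?_⟩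
    rintro _ ⟨p, rfl⟩
    exact (map_add_le_add p.toSeminorm x y).trans
      (add_le_add (hC ⟨p, rfl⟩) (hC' ⟨p, rfl⟩))

end CStarSeminorm

/-- The largest `C^*`-seminorm on the algebraic crossed product. -/
def maxNorm (x : α.AlgCrossed) : ℝ := ⨆ p : α.CStarSeminorm, p.toSeminorm x

namespace AlgCrossed

variable {α}

theorem le_maxNorm (p : α.CStarSeminorm) (x : α.AlgCrossed) : p.toSeminorm x ≤ α.maxNorm x :=
  le_ciSup (CStarSeminorm.bddAbove x) p

theorem maxNorm_nonneg (x : α.AlgCrossed) : 0 ≤ α.maxNorm x :=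
  (apply_nonneg _ x).trans (le_maxNorm default x)

/-- `maxNorm` as a seminorm. -/
def maxSeminorm : Seminorm ℂ α.AlgCrossed :=
  Seminorm.of α.maxNorm
    (fun x y => ciSup_le fun p => (map_add_le_add p.toSeminorm x y).trans
      (add_le_add (le_maxNorm p x) (le_maxNorm p y)))
    (fun c x => by
      simp only [maxNorm, map_smul_eq_mul]
      exact (Real.mul_iSup_of_nonneg (norm_nonneg c) _).symm)

instance : NonUnitalSeminormedRing α.AlgCrossed :=
  { maxSeminorm.toAddGroupSeminorm.toSeminormedAddCommGroup,
    (inferInstance : NonUnitalRing α.AlgCrossed) with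
    norm_mul_le := fun x y => by
      refine ciSup_le fun p => (p.mul_le' x y).trans ?_
      exact mul_le_mul (le_maxNorm p x) (le_maxNorm p y) (apply_nonneg p.toSeminorm y)
        (maxNorm_nonneg x) }

instance : NormedSpace ℂ α.AlgCrossed where
  norm_smul_le c x := (map_smul_eq_mul maxSeminorm c x).le

instance : PreCStarAlgebra α.AlgCrossed where
  norm_star_mul_self' x := by
    change α.maxNorm (star x * x) = α.maxNorm x ^ 2
    refine le_antisymm (ciSup_le fun p => ?_) ?_
    · have := p.star_mul_self' x
      exact this.le.trans (pow_le_pow_left₀ (apply_nonneg p.toSeminorm x) (le_maxNorm p x) 2)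
    · refine (Real.le_sqrt (maxNorm_nonneg _) (maxNorm_nonneg _)).1 (ciSup_le fun p => ?_)
      refine Real.le_sqrt_of_sq_le ?_
      have := p.star_mul_self' x
      exact this.ge.trans (le_maxNorm p (star x * x))

end AlgCrossed

/-- The (full) partial crossed product `A ⋊_α G`: the Hausdorff completion of the algebraic crossed
product with respect to its largest `C^*`-seminorm. -/
def Crossed : Type (max u v) := PreCStarAlgebra.Compl α.AlgCrossed

instance : NonUnitalCStarAlgebra α.Crossed :=
  inferInstanceAs (NonUnitalCStarAlgebra (PreCStarAlgebra.Compl α.AlgCrossed))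

instance : PartialOrder α.Crossed := CStarAlgebra.spectralOrder _
instance : StarOrderedRing α.Crossed := CStarAlgebra.spectralOrderedRing _

/-- The canonical element `a δ_g ∈ A ⋊_α G`, for `a ∈ A_g`. -/
def delta (g : G) (a : α.D g) : α.Crossed := PreCStarAlgebra.toC (AlgCrossed.dl α g a)

/-! ### Restrictions of partial actions -/

section restrict

variable (I : ClosedIdeal A)

variable {α} in
theorem maps_mul_left_mem {g : G} {x a b c : A} (hb : b ∈ I) (h : α.Maps g b a)
    (hc : α.Maps g c (x * a)) : c ∈ I := by
  have hbJ : b ∈ I.inf (α.D g⁻¹) := ⟨hb, h.mem_left⟩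
  obtain ⟨l, hl, hlim⟩ := ClosedIdeal.exists_approxUnit (I.inf (α.D g⁻¹))
  have h1 := hlim ⟨b, hbJ⟩
  -- the map `D g⁻¹ → A`, `d ↦ α_g⁻¹ (x α_g(d))`
  let F : α.D g⁻¹ → A := fun d =>
    ((α.act g).symm ⟨x * α.act g d, (α.D g).mul_left_mem x (α.act g d).2⟩ : α.D g⁻¹)
  have hF : Continuous F := by
    refine continuous_subtype_val.comp ((continuous_act_symm g).comp ?_)
    exact Continuous.subtype_mk
      (continuous_const.mul (continuous_subtype_val.comp (continuous_act g))) _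
  let i : I.inf (α.D g⁻¹) → α.D g⁻¹ := fun d => ⟨d, d.2.2⟩
  have hi : Continuous i := Continuous.subtype_mk continuous_subtype_val _
  have h2 := ((hF.comp hi).tendsto _).comp h1
  have e1 : (F ∘ i) ⟨b, hbJ⟩ = c := by
    refine Maps.symm_eq ?_
    have : ((α.act g (i ⟨b, hbJ⟩) : α.D g) : A) = a := (maps_act g (i ⟨b, hbJ⟩)).unique h
    simpa only [this] using hc
  rw [e1] at h2
  refine I.isClosed.mem_of_tendsto h2 (Eventually.of_forall fun u => ?_)
  have e2 : (F ∘ i) (⟨b, hbJ⟩ * u) = c * u := by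
    refine Maps.symm_eq ?_
    have h3 := hc.mul (maps_act g (i u))
    have h4 := h.mul (maps_act g (i u))
    have h5 : ((α.act g (i (⟨b, hbJ⟩ * u)) : α.D g) : A) = a * α.act g (i u) :=
      (maps_act g (i (⟨b, hbJ⟩ * u))).unique h4
    simp only [h5]
    rwa [mul_assoc] at h3
  change (F ∘ i) (⟨b, hbJ⟩ * u) ∈ I
  rw [e2]
  exact I.mul_left_mem c u.2.1

/-- The ideal `I ∩ α_g(I ∩ A_{g⁻¹})` of `I`. It equals `I ∩ A_g` when `I` is invariant under `α`. -/
def restrictD (g : G) : ClosedIdeal I where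
  carrier := {a | ∃ b ∈ I, α.Maps g b a}
  zero_mem' := ⟨0, zero_mem _, maps_zero g⟩
  add_mem' := by
    rintro a a' ⟨b, hb, h⟩ ⟨b', hb', h'⟩
    exact ⟨b + b', add_mem hb hb', h.add h'⟩
  smul_mem' := by
    rintro c a ⟨b, hb, h⟩
    exact ⟨c • b, SMulMemClass.smul_mem c hb, h.smul c⟩
  star_mem' := by
    rintro a ⟨b, hb, h⟩
    exact ⟨star b, star_mem hb, h.star⟩
  mul_mem_left' := by
    rintro x a ⟨b, hb, h⟩
    have hm : (x : A) * a ∈ α.D g := (α.D g).mul_left_mem _ h.mem_right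
    exact ⟨_, maps_mul_left_mem I hb h (maps_symm g ⟨_, hm⟩), maps_symm g ⟨_, hm⟩⟩
  mul_mem_right' := by
    rintro x a ⟨b, hb, h⟩
    have hm : star (x : A) * star (a : A) ∈ α.D g := (α.D g).mul_left_mem _ h.star.mem_right
    have h1 := maps_symm g ⟨_, hm⟩
    have h2 := maps_mul_left_mem I (star_mem hb) h.star h1
    refine ⟨_, star_mem h2, ?_⟩
    simpa using h1.star
  isClosed' := by
    have h1 : IsClosed {d : α.D g | ((α.act g).symm d : A) ∈ I} :=
      I.isClosed.preimage (continuous_subtype_val.comp (continuous_act_symm g))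
    have h2 := (α.D g).isClosed.isClosedEmbedding_subtypeVal.isClosedMap _ h1
    have h3 := h2.preimage (continuous_subtype_val (p := (· ∈ I)))
    have e : {a : I | ∃ b ∈ I, α.Maps g b a} =
        Subtype.val ⁻¹' (Subtype.val '' {d : α.D g | ((α.act g).symm d : A) ∈ I}) := by
      ext a
      constructor
      · rintro ⟨b, hb, h⟩
        have h4 : ((α.act g).symm ⟨a, h.mem_right⟩ : A) ∈ I := by
          rwa [Maps.symm_eq (b := ⟨_, h.mem_right⟩) h]
        exact ⟨⟨a, h.mem_right⟩, h4, rfl⟩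
      · rintro ⟨d, hd, hda⟩
        exact ⟨_, hd, by rw [← hda]; exact maps_symm g d⟩
    exact (congrArg IsClosed e).mpr h3

variable {α I} in
theorem mem_restrictD {g : G} {a : I} : a ∈ α.restrictD I g ↔ ∃ b ∈ I, α.Maps g b a := Iff.rfl

variable {α I} in
theorem mem_restrictD_inv {g : G} {a : I} :
    a ∈ α.restrictD I g⁻¹ ↔ ∃ b ∈ I, α.Maps g a b := by
  simp only [mem_restrictD, maps_inv_iff]

/-- The restriction of `α_g` to `I_{g⁻¹} → I_g`. -/
def restrictFun (g : G) (a : α.restrictD I g⁻¹) : α.restrictD I g :=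
  have hm : ((a : I) : A) ∈ α.D g⁻¹ := by
    obtain ⟨b, _, h⟩ := mem_restrictD_inv.1 a.2; exact h.mem_left
  have hI : (α.act g ⟨a, hm⟩ : A) ∈ I := by
    obtain ⟨b, hb, h⟩ := mem_restrictD_inv.1 a.2
    rwa [← h.unique (maps_act g ⟨_, hm⟩)]
  ⟨⟨α.act g ⟨a, hm⟩, hI⟩, mem_restrictD.2 ⟨_, (a : I).2, maps_act g ⟨_, hm⟩⟩⟩

variable {α I} in
theorem maps_restrictFun (g : G) (a : α.restrictD I g⁻¹) :
    α.Maps g ((a : I) : A) ((α.restrictFun I g a : I) : A) := by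
  obtain ⟨b, _, h⟩ := mem_restrictD_inv.1 a.2
  exact ⟨h.mem_left, rfl⟩

/-- The inverse of `restrictFun`. -/
def restrictInv (g : G) (a : α.restrictD I g) : α.restrictD I g⁻¹ :=
  have hm : ((a : I) : A) ∈ α.D g := by
    obtain ⟨b, _, h⟩ := mem_restrictD.1 a.2; exact h.mem_right
  have hI : ((α.act g).symm ⟨a, hm⟩ : A) ∈ I := by
    obtain ⟨b, hb, h⟩ := mem_restrictD.1 a.2
    rwa [← h.unique_left (maps_symm g ⟨_, hm⟩)]
  ⟨⟨(α.act g).symm ⟨a, hm⟩, hI⟩, mem_restrictD_inv.2 ⟨_, (a : I).2, maps_symm g ⟨_, hm⟩⟩⟩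

variable {α I} in
theorem maps_restrictInv (g : G) (a : α.restrictD I g) :
    α.Maps g ((α.restrictInv I g a : I) : A) ((a : I) : A) := by
  obtain ⟨b, _, h⟩ := mem_restrictD.1 a.2
  exact maps_symm g ⟨_, h.mem_right⟩

/-- The isomorphism `I_{g⁻¹} → I_g` obtained by restricting `α_g`. -/
def restrictAct (g : G) : α.restrictD I g⁻¹ ≃⋆ₐ[ℂ] α.restrictD I g where
  toFun := α.restrictFun I g
  invFun := α.restrictInv I g
  left_inv a := Subtype.ext <| Subtype.ext <|
    (maps_restrictInv g _).unique_left (maps_restrictFun g a)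
  right_inv a := Subtype.ext <| Subtype.ext <|
    (maps_restrictFun g _).unique (maps_restrictInv g a)
  map_mul' a b := Subtype.ext <| Subtype.ext <|
    (maps_restrictFun g _).unique ((maps_restrictFun g a).mul (maps_restrictFun g b))
  map_add' a b := Subtype.ext <| Subtype.ext <|
    (maps_restrictFun g _).unique ((maps_restrictFun g a).add (maps_restrictFun g b))
  map_star' a := Subtype.ext <| Subtype.ext <|
    (maps_restrictFun g _).unique (maps_restrictFun g a).star
  map_smul' c a := Subtype.ext <| Subtype.ext <|
    (maps_restrictFun g _).unique ((maps_restrictFun g a).smul c)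

variable {α I} in
theorem maps_restrictAct (g : G) (a : α.restrictD I g⁻¹) :
    α.Maps g ((a : I) : A) ((α.restrictAct I g a : I) : A) := maps_restrictFun g a

/-- The restriction of a partial action to a closed ideal `I`, with domains
`I_g = I ∩ α_g(I ∩ A_{g⁻¹})`. -/
def restrictIdeal : PartialAction G I where
  D := α.restrictD I
  act := α.restrictAct I
  D_one a := mem_restrictD.2 ⟨a, a.2, maps_one _⟩
  act_one a := Subtype.ext (maps_restrictAct 1 a).one
  act_mul g h a ha := by
    have h1 := maps_restrictAct (α := α) (I := I) h a
    have h2 := maps_restrictAct (α := α) (I := I) g ⟨α.restrictAct I h a, ha⟩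
    have h3 := h1.comp h2
    have hm : (a : I) ∈ α.restrictD I (g * h)⁻¹ :=
      mem_restrictD_inv.2 ⟨_, Subtype.prop _, h3⟩
    have h4 := maps_restrictAct (α := α) (I := I) (g * h) ⟨a, hm⟩
    exact ⟨hm, Subtype.ext (h4.unique h3)⟩

/-- The restriction of a partial action to a subgroup. -/
def restrictSubgroup (H : Subgroup G) : PartialAction H A where
  D h := α.D (h : G)
  act h := α.act (h : G)
  D_one := α.D_one
  act_one := α.act_one
  act_mul g h := α.act_mul (g : G) (h : G)

end restrict

end PartialAction

/-! ### Tuples -/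

/-- `T_n(G)`: the subsets `τ` of `G` with `1 ∈ τ` and `|τ| = n`. -/
def Tuple (G : Type u) [Group G] (n : ℕ) : Type u := {τ : Set G // 1 ∈ τ ∧ τ.encard = n}

namespace Tuple

variable {G : Type u} [Group G] {n : ℕ}

/-- Two tuples are in the same orbit of the partial action of `G` on `T_n(G)` by left
multiplication (`g` acts on the tuples containing `g⁻¹`). -/
def SameOrbit (τ σ : Tuple G n) : Prop := ∃ g : G, g⁻¹ ∈ τ.1 ∧ g • τ.1 = σ.1

variable (G n) in
/-- The orbit equivalence relation on `T_n(G)`. -/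
def orbitSetoid : Setoid (Tuple G n) where
  r := SameOrbit
  iseqv :=
    { refl := fun τ => ⟨1, by simpa using τ.2.1, one_smul _ _⟩
      symm := by
        rintro τ σ ⟨g, hg, h⟩
        refine ⟨g⁻¹, ?_, by rw [← h, inv_smul_smul]⟩
        rw [← h, inv_inv]
        simpa using Set.smul_mem_smul_set (a := g) τ.2.1
      trans := by
        rintro τ σ ρ ⟨g, hg, h⟩ ⟨k, hk, h'⟩
        refine ⟨k * g, ?_, by rw [mul_smul, h, h']⟩
        rw [← h, Set.mem_smul_set_iff_inv_smul_mem] at hk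
        simpa using hk }

variable (G n) in
/-- The orbit space `O_n(G)`. -/
def OrbitSpace : Type u := Quotient (orbitSetoid G n)

/-- The quotient map `T_n(G) → O_n(G)`. -/
def orbit (τ : Tuple G n) : OrbitSpace G n := Quotient.mk (orbitSetoid G n) τ

/-- `H_τ = {h ∈ G | h τ = τ}`. -/
def stab (τ : Tuple G n) : Subgroup G := MulAction.stabilizer G τ.1

/-- `m_τ = n / |H_τ| - 1`. -/
def m (τ : Tuple G n) : ℕ := n / Nat.card τ.stab - 1

/-- `x_0 = 1` and `τ = H_τ x_0 ⊔ H_τ x_1 ⊔ ⋯ ⊔ H_τ x_m` (disjoint union). -/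
structure IsReps (τ : Tuple G n) (x : Fin (τ.m + 1) → G) : Prop where
  zero : x 0 = 1
  union : τ.1 = ⋃ j, (τ.stab : Set G) * {x j}
  disjoint : Pairwise fun j k => Disjoint ((τ.stab : Set G) * {x j}) ((τ.stab : Set G) * {x k})

theorem IsReps.mul_mem {τ : Tuple G n} {x : Fin (τ.m + 1) → G} (hx : τ.IsReps x) (h : τ.stab)
    (k : Fin (τ.m + 1)) : (h : G) * x k ∈ τ.1 := by
  rw [hx.union]
  exact Set.mem_iUnion.2 ⟨k, Set.mul_mem_mul h.2 rfl⟩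

theorem IsReps.mem {τ : Tuple G n} {x : Fin (τ.m + 1) → G} (hx : τ.IsReps x)
    (k : Fin (τ.m + 1)) : x k ∈ τ.1 := by
  simpa using hx.mul_mem 1 k

end Tuple

/-! ### The decomposition property -/

namespace PartialAction

variable {G : Type u} [Group G] {A : Type v} [NonUnitalCStarAlgebra A] (α : PartialAction G A)
variable {n : ℕ}

/-- `A_σ = ⋂_{g ∈ σ} A_g`. -/
def tupleIdeal (σ : Set G) : ClosedIdeal A where
  carrier := {a | ∀ g ∈ σ, a ∈ α.D g}
  zero_mem' _ _ := zero_mem _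
  add_mem' ha hb g hg := add_mem (ha g hg) (hb g hg)
  smul_mem' c _ ha g hg := SMulMemClass.smul_mem c (ha g hg)
  star_mem' ha g hg := star_mem (ha g hg)
  mul_mem_left' x _ ha g hg := (α.D g).mul_left_mem x (ha g hg)
  mul_mem_right' x _ ha g hg := (α.D g).mul_right_mem x (ha g hg)
  isClosed' := by
    have : {a | ∀ g ∈ σ, a ∈ α.D g} = ⋂ g ∈ σ, (α.D g : Set A) := by ext; simp
    rw [this]
    exact isClosed_biInter fun g _ => (α.D g).isClosed

/-- The `n`-decomposition property. -/
structure HasDecomposition (n : ℕ) : Prop where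
  sum_dense : ∀ a : A, a ∈ ClosedIdeal.closedSum fun τ : Tuple G n => α.tupleIdeal τ.1
  inter_trivial : ∀ (τ : Tuple G n) (g : G), g ∉ τ.1 →
    ∀ a : A, a ∈ α.tupleIdeal τ.1 → a ∈ α.D g → a = 0

/-- `A_{G·τ} = ∑_{g ∈ τ⁻¹} A_{gτ}`. -/
def orbitIdeal (τ : Tuple G n) : ClosedIdeal A :=
  ClosedIdeal.closedSum fun g : {g : G // g⁻¹ ∈ τ.1} => α.tupleIdeal (g.1 • τ.1)

/-- The restriction of `α` to `A_{G·τ}`. -/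
def onOrbit (τ : Tuple G n) : PartialAction G (α.orbitIdeal τ) := α.restrictIdeal (α.orbitIdeal τ)

/-- The action `α|_{H_τ}` of `H_τ` on `A_τ`. -/
def onTuple (τ : Tuple G n) : PartialAction τ.stab (α.tupleIdeal τ.1) :=
  (α.restrictSubgroup τ.stab).restrictIdeal (α.tupleIdeal τ.1)

/-- The `C^*`-algebra `M_{m_τ + 1}(A_τ ⋊ H_τ)`. -/
abbrev MatAlg (τ : Tuple G n) : Type (max u v) :=
  CStarMatrix (Fin (τ.m + 1)) (Fin (τ.m + 1)) (α.onTuple τ).Crossed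

variable {α}

theorem Maps.mem_tupleIdeal {g : G} {σ : Set G} {a b : A} (h : α.Maps g a b)
    (ha : a ∈ α.tupleIdeal σ) : b ∈ α.tupleIdeal (g • σ) := by
  rintro _ ⟨s, hs, rfl⟩
  exact h.mem_mul (ha s hs)

theorem mem_D_of_mem_tuple {τ : Set G} {y g : G} (hg : y * g ∈ τ) {a : A}
    (ha : a ∈ α.tupleIdeal (y⁻¹ • τ)) : a ∈ α.D g :=
  ha g (by rw [Set.mem_smul_set_iff_inv_smul_mem, inv_inv]; exact hg)

theorem mem_onOrbit {τ : Tuple G n} {y g : G} (hy : y ∈ τ.1) (hg : y * g ∈ τ.1) {a : A}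
    (ha : a ∈ α.tupleIdeal (y⁻¹ • τ.1)) :
    ∃ h : a ∈ α.orbitIdeal τ, (⟨a, h⟩ : α.orbitIdeal τ) ∈ (α.onOrbit τ).D g := by
  refine ⟨ClosedIdeal.mem_closedSum (I := fun g : {g : G // g⁻¹ ∈ τ.1} => α.tupleIdeal (g.1 • τ.1))
    ⟨y⁻¹, by rwa [inv_inv]⟩ ha, ?_⟩
  have h1 := maps_symm g ⟨a, mem_D_of_mem_tuple hg ha⟩
  refine mem_restrictD.2 ⟨_, ?_, h1⟩
  refine ClosedIdeal.mem_closedSum (I := fun g : {g : G // g⁻¹ ∈ τ.1} => α.tupleIdeal (g.1 • τ.1))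
    ⟨(y * g)⁻¹, by rwa [inv_inv]⟩ ?_
  have := h1.inv.mem_tupleIdeal ha
  rwa [smul_smul, ← mul_inv_rev] at this

theorem mem_onTuple {τ : Tuple G n} (h : τ.stab) (a : α.tupleIdeal τ.1) :
    a ∈ (α.onTuple τ).D h := by
  have hinv : (h : G)⁻¹ • τ.1 = τ.1 := (h⁻¹).2
  have hmem : (h : G) ∈ τ.1 := by
    have h2 : (h : G) • τ.1 = τ.1 := h.2
    rw [← h2]
    simpa using Set.smul_mem_smul_set (a := (h : G)) τ.2.1
  have h1 := maps_symm (α := α) (h : G) ⟨(a : A), a.2 _ hmem⟩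
  have h2 := h1.inv.mem_tupleIdeal a.2
  rw [hinv] at h2
  exact mem_restrictD.2 ⟨_, h2, h1⟩

variable (α)

/-- `α_y(a) ∈ A_τ`, for `a ∈ A_{y⁻¹τ}`. -/
def moveToBase (τ : Tuple G n) (y : G) (a : α.tupleIdeal (y⁻¹ • τ.1)) :
    α.tupleIdeal τ.1 :=
  have hm : (a : A) ∈ α.D y⁻¹ :=
    mem_D_of_mem_tuple (y := y) (by rw [mul_inv_cancel]; exact τ.2.1) a.2
  ⟨α.act y ⟨a, hm⟩, by
    have := (maps_act (α := α) y ⟨(a : A), hm⟩).mem_tupleIdeal a.2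
    rwa [smul_inv_smul] at this⟩

section generators

variable (τ : Tuple G n) {x : Fin (τ.m + 1) → G} (hx : τ.IsReps x)

variable {τ} in
theorem reps_mem (hx : τ.IsReps x) (j k : Fin (τ.m + 1)) (h : τ.stab) :
    x j * ((x j)⁻¹ * h * x k) ∈ τ.1 := by
  have := hx.mul_mem h k
  rwa [mul_assoc, mul_inv_cancel_left]

/-- The element `a δ_g` of `A ⋊_α G`, where `g = x_j⁻¹ h x_k` and `a ∈ A_{x_j⁻¹τ}`. -/
def genA (j k : Fin (τ.m + 1)) (h : τ.stab) (a : α.tupleIdeal ((x j)⁻¹ • τ.1)) : α.Crossed :=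
  α.delta ((x j)⁻¹ * h * x k) ⟨a, mem_D_of_mem_tuple (reps_mem hx j k h) a.2⟩

/-- The element `a δ_g` of `A_{G·τ} ⋊_α G`, where `g = x_j⁻¹ h x_k` and `a ∈ A_{x_j⁻¹τ}`. -/
def genOrbit (j k : Fin (τ.m + 1)) (h : τ.stab) (a : α.tupleIdeal ((x j)⁻¹ • τ.1)) :
    (α.onOrbit τ).Crossed :=
  (α.onOrbit τ).delta ((x j)⁻¹ * h * x k)
    ⟨⟨a, (mem_onOrbit (hx.mem j) (reps_mem hx j k h) a.2).1⟩,
      (mem_onOrbit (hx.mem j) (reps_mem hx j k h) a.2).2⟩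

/-- The element `α_{x_j}(a) v_h ⊗ e_{j,k}` of `M_{m+1}(A_τ ⋊ H_τ)`, where `c v_h = c δ_h`
for `c ∈ A_τ`. -/
def genMat (x : Fin (τ.m + 1) → G) (j k : Fin (τ.m + 1)) (h : τ.stab) (a : α.tupleIdeal ((x j)⁻¹ • τ.1)) : α.MatAlg τ :=
  CStarMatrix.ofMatrix <| Matrix.single j k <|
    (α.onTuple τ).delta h ⟨α.moveToBase τ (x j) a, mem_onTuple h _⟩

end generators

end PartialAction

/-! ### Direct sums of `C^*`-algebras -/

/-- The `C^*`-algebraic (i.e. `c_0`-) direct sum. -/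
def C0Sum {ι : Type u} (B : ι → Type v) [∀ i, NonUnitalCStarAlgebra (B i)] :
    NonUnitalStarSubalgebra ℂ (lp B ∞) where
  carrier := {f | Tendsto (fun i => ‖f i‖) cofinite (𝓝 0)}
  zero_mem' := by simpa using tendsto_const_nhds
  add_mem' {f g} hf hg := by
    have hf : Tendsto (fun i => ‖f i‖) cofinite (𝓝 0) := hf
    have hg : Tendsto (fun i => ‖g i‖) cofinite (𝓝 0) := hg
    exact squeeze_zero (fun _ => norm_nonneg _) (fun i => norm_add_le (f i) (g i))
      (by simpa using hf.add hg)
  mul_mem' {f g} hf hg := by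
    have hf : Tendsto (fun i => ‖f i‖) cofinite (𝓝 0) := hf
    have hg : Tendsto (fun i => ‖g i‖) cofinite (𝓝 0) := hg
    exact squeeze_zero (fun _ => norm_nonneg _) (fun i => norm_mul_le (f i) (g i))
      (by simpa using hf.mul hg)
  smul_mem' c f hf := by
    have hf : Tendsto (fun i => ‖f i‖) cofinite (𝓝 0) := hf
    exact squeeze_zero (fun _ => norm_nonneg _) (fun i => (norm_smul c (f i)).le)
      (by simpa using hf.const_mul ‖c‖)
  star_mem' {f} hf := by
    have hf : Tendsto (fun i => ‖f i‖) cofinite (𝓝 0) := hf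
    exact hf.congr fun i => (norm_star (f i)).symm

namespace C0Sum

variable {ι : Type u} (B : ι → Type v) [∀ i, NonUnitalCStarAlgebra (B i)]

theorem isClosed : IsClosed (C0Sum B : Set (lp B ∞)) := by
  refine isClosed_of_closure_subset fun f hf => ?_
  rw [Metric.mem_closure_iff] at hf
  change Tendsto (fun i => ‖f i‖) cofinite (𝓝 0)
  rw [Metric.tendsto_nhds]
  intro ε hε
  obtain ⟨g, hg, hfg⟩ := hf (ε / 2) (half_pos hε)
  have hg : Tendsto (fun i => ‖g i‖) cofinite (𝓝 0) := hg
  filter_upwards [(Metric.tendsto_nhds.1 hg) (ε / 2) (half_pos hε)] with i hi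
  rw [Real.dist_eq, sub_zero, abs_norm] at hi ⊢
  have h1 : ‖(f - g) i‖ ≤ ‖f - g‖ := lp.norm_apply_le_norm ENNReal.top_ne_zero _ i
  rw [dist_eq_norm] at hfg
  have h2 : ‖f i‖ ≤ ‖(f - g) i‖ + ‖g i‖ := by
    have : f i = (f - g) i + g i := by simp
    rw [this]; exact norm_add_le _ _
  linarith

instance : NonUnitalCStarAlgebra (C0Sum B) :=
  NonUnitalStarSubalgebra.nonUnitalCStarAlgebra (C0Sum B) (h_closed := isClosed B)

open Classical in
/-- The element of the direct sum with `b` in the `i`-th summand and `0` elsewhere. -/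
def single (i : ι) (b : B i) : C0Sum B :=
  ⟨lp.single ∞ i b, by
    refine tendsto_const_nhds.congr' ?_
    filter_upwards [(Set.finite_singleton i).compl_mem_cofinite] with j hj
    rw [lp.single_apply_ne ∞ i b hj, norm_zero]⟩

end C0Sum

end PartialCrossed

end

open PartialCrossed
open scoped Pointwise

noncomputable section

open Filter Topology
open scoped Pointwise ENNReal DirectSum

namespace PartialCrossed

universe u v w

namespace PartialAction

variable {G : Type u} [Group G] {A : Type v} [NonUnitalCStarAlgebra A] {α : PartialAction G A}

/-! ### The universal property of the full crossed product -/

/-! Two distinct sets in `T_n(G)` have the same finite cardinality, so neither contains the other,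
and the second half of the decomposition property makes the ideals `A_σ`, `σ ∈ T_n(G)`, pairwise
orthogonal (`mul_eq_zero_of_mem`). Their sum is dense, so every `a ∈ A` has a component in each
`A_σ`, and taking components is a contractive `*`-homomorphism (`IsProj`, `exists_isProj`).

Fix `τ` and representatives `x_j`. The sets in the orbit of `τ` are exactly the `x_j⁻¹τ`. A nonzero
`a ∈ A_{x_j⁻¹τ}` lies in `A_g` only if `x_j g ∈ τ`, that is, `x_j g = h x_k` for some `h ∈ H_τ` and
some `k`; then `α_g` carries `A_{x_k⁻¹τ}` to `A_{x_j⁻¹τ}`. Identifying each `A_{x_j⁻¹τ}` with `A_τ`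
through `α_{x_j}` turns `α_g` into `α_h` (`IsBase.maps`), so `a δ_g` behaves like `α_{x_j}(a) v_h ⊗
e_{j,k}`.

This gives maps in both directions. `fwd` is defined on all of `A ⋊ G`: the `(j,k)` entry of the
image of `a δ_g` is `c v_h` if `x_j g x_k⁻¹ = h ∈ H_τ`, where `c` is the component of `a` in
`A_{x_j⁻¹τ}` moved to `A_τ`, and `0` otherwise. `bwd` adds up corner maps `A_τ ⋊ H_τ → A_{G·τ} ⋊ G`.
For `fwd`, continuity is the universal property of the full crossed product. An off-diagonal corner
map is not multiplicative, but the `C^*`-identity bounds it by a diagonal one (`norm_bwdAlg_le`).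
The maps are mutually inverse because they are so on generators, whose closed span is everything.

For the direct sum, the images of the matrix algebras of different orbits in `A ⋊ G` are orthogonal,
and `u · bwdIncl M = bwdIncl (fwd u · M)`. An element killed by every `fwd` therefore annihilates
all generators and is zero. The image is closed, being isometric, and contains the finitely
supported families, hence is the whole `c_0`-sum. Uniqueness in both parts is density of the
generators. -/

theorem AlgCrossed.dl_mul_dl_of_maps {g h k : G} {a : α.D g} {b : α.D h} {d : α.D k} {c : A}
    (hk : g * h = k) (hc : α.Maps g c a) (hd : α.Maps g (c * b) d) :
    dl α g a * dl α h b = dl α k d := by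
  rw [dl_mul_dl]
  refine dl_congr hk ?_
  have := maps_tw g a (b : A)
  rw [Maps.symm_eq hc] at this
  exact this.unique hd

theorem AlgCrossed.star_dl_of_maps {g k : G} {a : α.D g} {b : α.D k} (hk : g⁻¹ = k)
    (h : α.Maps g (b : A) (star (a : A))) : star (dl α g a) = dl α k b := by
  rw [star_dl]
  exact dl_congr hk (Maps.symm_eq h)

theorem AlgCrossed.dl_smul (c : ℂ) (g : G) (a : α.D g) : dl α g (c • a) = c • dl α g a :=
  (smul_dl c g a).symm

section lift

variable {C : Type w}

theorem AlgCrossed.lift_smul [AddCommMonoid C] [Module ℂ C] (f : ∀ g, α.D g →ₗ[ℂ] C) (c : ℂ)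
    (x : α.AlgCrossed) : lift α (fun g => (f g).toAddMonoidHom) (c • x) =
      c • lift α (fun g => (f g).toAddMonoidHom) x := by
  induction x using AlgCrossed.ind with
  | zero => simp
  | add x y hx hy => simp only [smul_add, map_add, hx, hy]
  | of g a =>
    rw [smul_dl, lift_dl, lift_dl]
    exact map_smul (f g) c a

/-- The linear map determined by its values on the elements `a δ_g`. -/
def AlgCrossed.liftₗ [AddCommMonoid C] [Module ℂ C] (f : ∀ g, α.D g →ₗ[ℂ] C) :
    α.AlgCrossed →ₗ[ℂ] C where
  toFun := lift α fun g => (f g).toAddMonoidHom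
  map_add' := map_add _
  map_smul' := lift_smul f

theorem AlgCrossed.liftₗ_dl [AddCommMonoid C] [Module ℂ C] (f : ∀ g, α.D g →ₗ[ℂ] C) (g : G)
    (a : α.D g) : liftₗ f (dl α g a) = f g a :=
  lift_dl (fun g => (f g).toAddMonoidHom) g a

variable [NonUnitalCStarAlgebra C]

/-- The `*`-homomorphism determined by its values on the elements `a δ_g`. -/
def AlgCrossed.liftHom (f : ∀ g, α.D g →ₗ[ℂ] C)
    (hmul : ∀ (g h : G) (a : α.D g) (b : α.D h) (d : α.D (g * h)) (c : A), α.Maps g c a →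
      α.Maps g (c * b) d → f g a * f h b = f (g * h) d)
    (hstar : ∀ (g : G) (a : α.D g) (b : α.D g⁻¹), α.Maps g (b : A) (star (a : A)) →
      star (f g a) = f g⁻¹ b) : α.AlgCrossed →⋆ₙₐ[ℂ] C where
  toFun := liftₗ f
  map_zero' := map_zero _
  map_add' := map_add _
  map_smul' c x := map_smul _ c x
  map_mul' x y := by
    induction x using AlgCrossed.ind with
    | zero => simp
    | add x x' hx hx' => simp only [add_mul, map_add, hx, hx']
    | of g a =>
    induction y using AlgCrossed.ind with
    | zero => simp
    | add x x' hx hx' => simp only [mul_add, map_add, hx, hx']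
    | of h b =>
    rw [dl_mul_dl, liftₗ_dl, liftₗ_dl, liftₗ_dl]
    exact (hmul g h a b _ _ (maps_symm g a) (maps_tw g a b)).symm
  map_star' x := by
    induction x using AlgCrossed.ind with
    | zero => simp
    | add x x' hx hx' => simp only [star_add, map_add, hx, hx']
    | of g a =>
    rw [star_dl, liftₗ_dl, liftₗ_dl]
    exact (hstar g a _ (maps_symm g (star a))).symm

theorem AlgCrossed.liftHom_dl (f : ∀ g, α.D g →ₗ[ℂ] C) (hmul) (hstar) (g : G) (a : α.D g) :
    liftHom f hmul hstar (dl α g a) = f g a :=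
  liftₗ_dl f g a

variable (α) in
/-- The map `a ↦ a δ_1` as a `*`-homomorphism. -/
def AlgCrossed.base : A →⋆ₙₐ[ℂ] α.AlgCrossed where
  toFun a := dl α 1 ⟨a, α.D_one a⟩
  map_zero' := map_zero (dl α 1)
  map_add' a b := map_add (dl α 1) ⟨a, α.D_one a⟩ ⟨b, α.D_one b⟩
  map_smul' c a := dl_smul c 1 ⟨a, α.D_one a⟩
  map_mul' a b := (dl_mul_dl_of_maps (mul_one 1) (maps_one a) (maps_one (a * b))).symm
  map_star' a := (star_dl_of_maps inv_one (maps_one (star a))).symm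

/-- Since `(a δ_g)(a δ_g)^* = aa^* δ_1`, the `C^*`-identity reduces the bound to `g = 1`, where `a ↦
f (a δ_1)` is a `*`-homomorphism between `C^*`-algebras and hence contractive. -/
theorem AlgCrossed.norm_hom_dl_le (f : α.AlgCrossed →⋆ₙₐ[ℂ] C) (g : G) (a : α.D g) :
    ‖f (dl α g a)‖ ≤ ‖a‖ := by
  have h1 : dl α g a * star (dl α g a) = base α (a * star a : A) := by
    rw [star_dl]
    refine dl_mul_dl_of_maps (mul_inv_cancel g) (maps_symm g a) ?_
    exact (maps_symm g a).mul (maps_symm g (star a))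
  have h2 : ‖f (dl α g a)‖ * ‖f (dl α g a)‖ ≤ ‖a‖ * ‖a‖ := by
    rw [← CStarRing.norm_self_mul_star, ← map_star, ← map_mul, h1]
    refine (NonUnitalStarAlgHom.norm_apply_le (f.comp (base α)) (a * star a : A)).trans ?_
    exact (CStarRing.norm_self_mul_star (x := (a : A))).le
  nlinarith [norm_nonneg (f (dl α g a)), norm_nonneg a]

/-- The function `x ↦ ‖f x‖` is itself one of the `C^*`-seminorms whose supremum is the norm of the
algebraic crossed product. -/
theorem AlgCrossed.norm_hom_le (f : α.AlgCrossed →⋆ₙₐ[ℂ] C) (x : α.AlgCrossed) : ‖f x‖ ≤ ‖x‖ := by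
  let p : α.CStarSeminorm :=
    { Seminorm.of (fun x => ‖f x‖) (fun x y => by rw [map_add]; exact norm_add_le _ _)
        (fun c x => by rw [map_smul, norm_smul]) with
      mul_le' := fun x y => by
        change ‖f (x * y)‖ ≤ ‖f x‖ * ‖f y‖
        rw [map_mul]; exact norm_mul_le _ _
      star_mul_self' := fun x => by
        change ‖f (star x * x)‖ = ‖f x‖ ^ 2
        rw [map_mul, map_star, CStarRing.norm_star_mul_self, sq]
      dl_le' := norm_hom_dl_le f }
  exact le_maxNorm p x

variable (α) in
/-- The canonical map from the algebraic to the full crossed product. -/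
def AlgCrossed.toCrossed : α.AlgCrossed →⋆ₙₐ[ℂ] α.Crossed where
  toFun := PreCStarAlgebra.toC
  map_zero' := PreCStarAlgebra.toC_zero
  map_add' := PreCStarAlgebra.toC_add
  map_smul' c x := PreCStarAlgebra.toC_smul c x
  map_mul' := PreCStarAlgebra.toC_mul
  map_star' := PreCStarAlgebra.toC_star

theorem AlgCrossed.toCrossed_dl (g : G) (a : α.D g) : toCrossed α (dl α g a) = α.delta g a := rfl

theorem AlgCrossed.norm_toCrossed (x : α.AlgCrossed) : ‖toCrossed α x‖ = ‖x‖ :=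
  PreCStarAlgebra.norm_toC x

theorem AlgCrossed.denseRange_toCrossed : DenseRange (toCrossed α) :=
  PreCStarAlgebra.denseRange_toC

/-- Extension of a contractive linear map from the algebraic to the full crossed product. -/
def Crossed.extend (f : α.AlgCrossed →ₗ[ℂ] C) : α.Crossed →L[ℂ] C :=
  f.extendOfNorm (AlgCrossed.toCrossed α : α.AlgCrossed →ₗ[ℂ] α.Crossed)

theorem Crossed.extend_toCrossed (f : α.AlgCrossed →ₗ[ℂ] C) (hf : ∀ x, ‖f x‖ ≤ ‖x‖)
    (x : α.AlgCrossed) : Crossed.extend f (AlgCrossed.toCrossed α x) = f x :=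
  f.extendOfNorm_eq (e := (AlgCrossed.toCrossed α : α.AlgCrossed →ₗ[ℂ] α.Crossed))
    AlgCrossed.denseRange_toCrossed ⟨1, fun x => by
    rw [one_mul]; exact (hf x).trans (AlgCrossed.norm_toCrossed x).ge⟩ x

/-- The `*`-homomorphism on the full crossed product extending one on the algebraic crossed
product. -/
def Crossed.extendHom (f : α.AlgCrossed →⋆ₙₐ[ℂ] C) : α.Crossed →⋆ₙₐ[ℂ] C :=
  let F := Crossed.extend (f : α.AlgCrossed →ₗ[ℂ] C)
  have hF : ∀ x, F (AlgCrossed.toCrossed α x) = f x :=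
    Crossed.extend_toCrossed (f : α.AlgCrossed →ₗ[ℂ] C) (AlgCrossed.norm_hom_le f)
  { toFun := F
    map_zero' := map_zero F
    map_add' := map_add F
    map_smul' := map_smul F
    map_mul' := fun x y => by
      refine AlgCrossed.denseRange_toCrossed.induction_on₂
        (p := fun x y => F (x * y) = F x * F y) ?_ ?_ x y
      · exact isClosed_eq (by fun_prop) (by fun_prop)
      · intro x y
        rw [← map_mul, hF, hF, hF, map_mul]
    map_star' := fun x => by
      refine AlgCrossed.denseRange_toCrossed.induction_on (p := fun x => F (star x) = star (F x))
        x ?_ ?_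
      · exact isClosed_eq (by fun_prop) (by fun_prop)
      · intro x
        rw [← map_star, hF, hF, map_star] }

theorem Crossed.extendHom_toCrossed (f : α.AlgCrossed →⋆ₙₐ[ℂ] C) (x : α.AlgCrossed) :
    Crossed.extendHom f (AlgCrossed.toCrossed α x) = f x :=
  Crossed.extend_toCrossed (f : α.AlgCrossed →ₗ[ℂ] C) (AlgCrossed.norm_hom_le f) x

end lift

theorem norm_delta_le (g : G) (a : α.D g) : ‖α.delta g a‖ ≤ ‖a‖ :=
  AlgCrossed.norm_hom_dl_le (AlgCrossed.toCrossed α) g a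

variable (α) in
/-- The map `a ↦ a δ_g` as a linear map. -/
def deltaₗ (g : G) : α.D g →ₗ[ℂ] α.Crossed where
  toFun := α.delta g
  map_add' a b := by
    simp only [← AlgCrossed.toCrossed_dl, map_add]
  map_smul' c a := by
    simp only [← AlgCrossed.toCrossed_dl, AlgCrossed.dl_smul, map_smul, RingHom.id_apply]

theorem delta_zero (g : G) : α.delta g 0 = 0 := map_zero (α.deltaₗ g)

theorem continuous_delta (g : G) : Continuous (α.delta g) :=
  AddMonoidHomClass.continuous_of_bound (α.deltaₗ g) 1 fun a => by
    rw [one_mul]; exact norm_delta_le g a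

theorem delta_congr {g g' : G} {a : α.D g} {a' : α.D g'} (hg : g = g') (h : (a : A) = a') :
    α.delta g a = α.delta g' a' :=
  congrArg (AlgCrossed.toCrossed α) (AlgCrossed.dl_congr hg h)

/-- The twisted product is described by the graph `Maps`, with `g * h = k` as a hypothesis. All
later computations of products thus become statements about elements of `A`, without transport
between the ideals of equal group elements. -/
theorem delta_mul_delta_of_maps {g h k : G} {a : α.D g} {b : α.D h} {d : α.D k} {c : A}
    (hk : g * h = k) (hc : α.Maps g c a) (hd : α.Maps g (c * b) d) :
    α.delta g a * α.delta h b = α.delta k d := by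
  rw [← AlgCrossed.toCrossed_dl, ← AlgCrossed.toCrossed_dl, ← map_mul,
    AlgCrossed.dl_mul_dl_of_maps hk hc hd, AlgCrossed.toCrossed_dl]

theorem star_delta_of_maps {g k : G} {a : α.D g} {b : α.D k} (hk : g⁻¹ = k)
    (h : α.Maps g (b : A) (star (a : A))) : star (α.delta g a) = α.delta k b := by
  rw [← AlgCrossed.toCrossed_dl, ← map_star, AlgCrossed.star_dl_of_maps hk h,
    AlgCrossed.toCrossed_dl]

/-- A closed subspace of `A ⋊_α G` containing all `a δ_g`, where `a` is in the intersection of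
`A_g` with a subset of `A` spanning a dense ideal, is everything. -/
theorem Crossed.eq_top_of_delta_mem (S : Submodule ℂ α.Crossed) (hS : IsClosed (S : Set α.Crossed))
    (T : Set A) (hT : ∀ a, a ∈ (Submodule.span ℂ T).topologicalClosure)
    (h : ∀ (g : G) (a : α.D g), ∀ b ∈ T,
      α.delta g ⟨a * b, (α.D g).mul_right_mem b a.2⟩ ∈ S) : S = ⊤ := by
  have key : ∀ (g : G) (a : α.D g) (b : A),
      α.delta g ⟨a * b, (α.D g).mul_right_mem b a.2⟩ ∈ S := by
    intro g a
    let F : A →ₗ[ℂ] α.D g :=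
      { toFun := fun b => ⟨a * b, (α.D g).mul_right_mem b a.2⟩
        map_add' := fun b c => Subtype.ext (mul_add _ _ _)
        map_smul' := fun c b => Subtype.ext (mul_smul_comm _ _ _) }
    have hF : Continuous F := Continuous.subtype_mk (by fun_prop) _
    have hcl : IsClosed ((S.comap (α.deltaₗ g ∘ₗ F) : Submodule ℂ A) : Set A) :=
      hS.preimage ((continuous_delta g).comp hF)
    intro b
    exact Submodule.topologicalClosure_minimal _
      (Submodule.span_le.2 fun b hb => h g a b hb) hcl (hT b)
  refine eq_top_iff.2 fun x _ => ?_
  refine AlgCrossed.denseRange_toCrossed.induction_on (p := (· ∈ S)) x hS fun x => ?_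
  induction x using AlgCrossed.ind with
  | zero => simp
  | add x y hx hy => rw [map_add]; exact add_mem hx hy
  | of g a =>
    -- An approximate unit of `A_g` gives `a = lim a u`, and each `(a u) δ_g` is already in `S` by
    -- `key`.
    obtain ⟨l, hl, hlim⟩ := ClosedIdeal.exists_approxUnit (α.D g)
    refine hS.mem_of_tendsto (((continuous_delta g).tendsto a).comp (hlim a))
      (Eventually.of_forall fun u => ?_)
    exact key g a u

end PartialAction

namespace PartialAction

variable {G : Type u} [Group G] {A : Type v} [NonUnitalCStarAlgebra A] {α : PartialAction G A}

/-! ### Restrictions -/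

/-- The domain of the restricted map requires only that the element and its image lie in `I`, which
is built into the types of `a` and `b`. Relations in restricted crossed products can therefore be
checked in `A`. -/
theorem maps_restrictIdeal_iff {I : ClosedIdeal A} {g : G} {a b : I} :
    (α.restrictIdeal I).Maps g a b ↔ α.Maps g (a : A) (b : A) := by
  constructor
  · rintro ⟨h, e⟩
    have := maps_restrictAct (α := α) (I := I) g ⟨a, h⟩
    rw [← e]
    exact this
  · intro h
    have hm : a ∈ α.restrictD I g⁻¹ := mem_restrictD_inv.2 ⟨b, b.2, h⟩
    exact ⟨hm, Subtype.ext ((maps_restrictAct (α := α) (I := I) g ⟨a, hm⟩).unique h)⟩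

theorem mem_D_of_mem_restrictD {I : ClosedIdeal A} {g : G} {a : I} (h : a ∈ α.restrictD I g) :
    (a : A) ∈ α.D g := by
  obtain ⟨b, _, h⟩ := mem_restrictD.1 h
  exact h.mem_right

variable (α) in
/-- The map `a ↦ a δ_g` from `I_g` to `A ⋊ G`. -/
def inclₗ (I : ClosedIdeal A) (g : G) : (α.restrictIdeal I).D g →ₗ[ℂ] α.Crossed where
  toFun a := α.delta g ⟨((a : I) : A), mem_D_of_mem_restrictD a.2⟩
  map_add' _ _ := map_add (α.deltaₗ g) ⟨_, _⟩ ⟨_, _⟩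
  map_smul' c _ := map_smul (α.deltaₗ g) c ⟨_, _⟩

variable (α) in
/-- The canonical map `I ⋊ G → A ⋊ G` for a closed ideal `I`. -/
def inclHom (I : ClosedIdeal A) : (α.restrictIdeal I).Crossed →⋆ₙₐ[ℂ] α.Crossed :=
  Crossed.extendHom <| AlgCrossed.liftHom (α.inclₗ I)
    (fun _ _ _ _ _ _ hc hd => delta_mul_delta_of_maps rfl
      (maps_restrictIdeal_iff (I := I).1 hc) (maps_restrictIdeal_iff (I := I).1 hd))
    (fun _ _ _ hb => star_delta_of_maps rfl (maps_restrictIdeal_iff (I := I).1 hb))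

theorem inclHom_delta {I : ClosedIdeal A} (g : G) (a : (α.restrictIdeal I).D g) :
    α.inclHom I ((α.restrictIdeal I).delta g a) =
      α.delta g ⟨((a : I) : A), mem_D_of_mem_restrictD a.2⟩ := by
  rw [inclHom, ← AlgCrossed.toCrossed_dl, Crossed.extendHom_toCrossed]
  exact AlgCrossed.liftHom_dl (α.inclₗ I) _ _ g a

end PartialAction

namespace Tuple

variable {G : Type u} [Group G] {n : ℕ}

/-! ### Combinatorics of tuples -/

theorem finite (τ : Tuple G n) : τ.1.Finite :=
  Set.finite_of_encard_eq_coe τ.2.2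

/-- This is where the finite common cardinality enters: an inclusion between two such sets is an
equality. -/
theorem exists_mem_notMem {τ σ : Tuple G n} (h : τ ≠ σ) : ∃ g ∈ σ.1, g ∉ τ.1 := by
  by_contra! hc
  refine h (Subtype.ext ?_)
  symm
  exact σ.finite.eq_of_subset_of_encard_le hc (by rw [τ.2.2, σ.2.2])

/-- The tuple `y⁻¹ τ`, for `y ∈ τ`. -/
def shift (τ : Tuple G n) (y : G) (hy : y ∈ τ.1) : Tuple G n :=
  ⟨y⁻¹ • τ.1, by rw [Set.mem_smul_set_iff_inv_smul_mem]; simpa using hy, by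
    rw [Set.encard_smul_set, τ.2.2]⟩

theorem smul_eq {τ : Tuple G n} (h : τ.stab) : (h : G) • τ.1 = τ.1 := h.2

theorem inv_smul_eq {τ : Tuple G n} (h : τ.stab) : (h : G)⁻¹ • τ.1 = τ.1 := (h⁻¹).2

theorem stab_mul_mem {τ : Tuple G n} (h : τ.stab) {y : G} (hy : y ∈ τ.1) : (h : G) * y ∈ τ.1 := by
  rw [← smul_eq h]
  exact Set.smul_mem_smul_set hy

theorem stab_mem {τ : Tuple G n} (h : τ.stab) : (h : G) ∈ τ.1 := by
  simpa using stab_mul_mem h τ.2.1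

/-- The set `τ` is stable under left multiplication by `H_τ`, hence is a disjoint union of right
cosets, each of size `|H_τ|`; counting shows that there are `n / |H_τ|` of them. -/
theorem exists_isReps (τ : Tuple G n) : ∃ x : Fin (τ.m + 1) → G, τ.IsReps x := by
  classical
  let r := QuotientGroup.rightRel τ.stab
  let q : G → Quotient r := Quotient.mk r
  have hq : ∀ a b : G, q a = q b ↔ b * a⁻¹ ∈ τ.stab := fun a b =>
    Quotient.eq.trans QuotientGroup.rightRel_apply
  let S : Set (Quotient r) := q '' τ.1
  -- The coset of `1` is given the representative `1`, since `x_0 = 1` is required.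
  let rep : Quotient r → G := fun s => if s = q 1 then 1 else s.out
  have hrep : ∀ s, q (rep s) = s := fun s => by
    by_cases h : s = q 1
    · simp [rep, h]
    · simp only [rep, h, if_false]
      exact Quotient.out_eq s
  have hmem : ∀ s ∈ S, rep s ∈ τ.1 := by
    rintro s ⟨y, hy, rfl⟩
    have h1 := (hq _ _).1 (hrep (q y)).symm
    simpa using stab_mul_mem ⟨_, h1⟩ hy
  have hSfin : Finite S := (τ.finite.image q).to_subtype
  let F : τ.stab × S → τ.1 := fun p => ⟨p.1 * rep p.2, stab_mul_mem p.1 (hmem _ p.2.2)⟩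
  have hqF : ∀ p, q (F p) = p.2 := fun p => by
    rw [← hrep p.2, hq]
    simp [F]
  have hF : Function.Bijective F := by
    constructor
    · intro p p' hp
      have h2 : p.2 = p'.2 := Subtype.ext (by rw [← hqF, ← hqF, hp])
      refine Prod.ext (Subtype.ext ?_) h2
      have h3 := congrArg Subtype.val hp
      simp only [F, h2] at h3
      exact mul_right_cancel h3
    · rintro ⟨y, hy⟩
      have h1 := (hq _ _).1 (hrep (q y))
      exact ⟨⟨⟨_, h1⟩, ⟨q y, y, hy, rfl⟩⟩, Subtype.ext (by simp [F])⟩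
  have hcard : Nat.card τ.stab * Nat.card S = n := by
    rw [← Nat.card_prod, Nat.card_congr (Equiv.ofBijective F hF), Nat.card_coe_set_eq,
      Set.ncard, τ.2.2, ENat.toNat_natCast]
  have hS1 : q 1 ∈ S := ⟨1, τ.2.1, rfl⟩
  have : Nonempty S := ⟨⟨q 1, hS1⟩⟩
  have hSpos : 0 < Nat.card S := Nat.card_pos
  have hfinH : Finite τ.stab :=
    (τ.finite.subset (fun h (hh : h ∈ (τ.stab : Set G)) => stab_mem ⟨h, hh⟩)).to_subtype
  -- The truncated subtraction in `m` loses nothing, because `S` contains the coset of `1` and so is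
  -- nonempty.
  have hm : Nat.card S = τ.m + 1 := by
    have h1 : n / Nat.card τ.stab = Nat.card S :=
      Nat.div_eq_of_eq_mul_right Nat.card_pos hcard.symm
    rw [m, h1]
    omega
  let e₀ : S ≃ Fin (τ.m + 1) := Finite.equivFinOfCardEq hm
  -- The transposition moves the coset of `1` to index `0`.
  let e : Fin (τ.m + 1) ≃ S := (Equiv.swap 0 (e₀ ⟨q 1, hS1⟩)).trans e₀.symm
  have he0 : e 0 = ⟨q 1, hS1⟩ := by simp [e]
  refine ⟨fun j => rep (e j), by simp [he0, rep], ?_, ?_⟩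
  · ext y
    rw [Set.mem_iUnion]
    constructor
    · intro hy
      obtain ⟨p, hp⟩ := hF.2 ⟨y, hy⟩
      refine ⟨e.symm p.2, Set.mem_mul.2 ⟨p.1, p.1.2, _, rfl, ?_⟩⟩
      rw [e.apply_symm_apply]
      exact congrArg Subtype.val hp
    · rintro ⟨j, hj⟩
      obtain ⟨h, hh, _, rfl, rfl⟩ := Set.mem_mul.1 hj
      exact stab_mul_mem ⟨h, hh⟩ (hmem _ (e j).2)
  · intro j k hjk
    rw [Set.disjoint_left]
    intro y hj hk
    obtain ⟨h, hh, _, rfl, rfl⟩ := Set.mem_mul.1 hj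
    obtain ⟨h', hh', _, rfl, e'⟩ := Set.mem_mul.1 hk
    refine hjk (e.injective (Subtype.ext ?_))
    have h1 := hqF ⟨⟨h, hh⟩, e j⟩
    have h2 := hqF ⟨⟨h', hh'⟩, e k⟩
    rw [← h1, ← h2]
    exact congrArg q e'.symm

namespace IsReps

variable {τ : Tuple G n} {x : Fin (τ.m + 1) → G}

theorem exists_eq (hx : τ.IsReps x) {g : G} (hg : g ∈ τ.1) :
    ∃ (h : τ.stab) (k : Fin (τ.m + 1)), g = h * x k := by
  rw [hx.union] at hg
  obtain ⟨k, hk⟩ := Set.mem_iUnion.1 hg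
  obtain ⟨h, hh, _, rfl, rfl⟩ := Set.mem_mul.1 hk
  exact ⟨⟨h, hh⟩, k, rfl⟩

theorem eq_of_mul_inv_mem (hx : τ.IsReps x) {j k : Fin (τ.m + 1)} (h : x j * (x k)⁻¹ ∈ τ.stab) :
    j = k := by
  by_contra hjk
  refine Set.disjoint_left.1 (hx.disjoint hjk) (Set.mem_mul.2 ⟨1, one_mem _, x j, rfl, one_mul _⟩)
    (Set.mem_mul.2 ⟨_, h, x k, rfl, by simp⟩)

theorem eq_of_smul_eq (hx : τ.IsReps x) {j k : Fin (τ.m + 1)}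
    (h : (x j)⁻¹ • τ.1 = (x k)⁻¹ • τ.1) : j = k := by
  refine (hx.eq_of_mul_inv_mem ?_).symm
  change (x k * (x j)⁻¹) • τ.1 = τ.1
  rw [mul_smul, h, smul_inv_smul]

theorem exists_smul_eq (hx : τ.IsReps x) {g : G} (hg : g⁻¹ ∈ τ.1) :
    ∃ j, g • τ.1 = (x j)⁻¹ • τ.1 := by
  obtain ⟨h, k, e⟩ := hx.exists_eq hg
  refine ⟨k, ?_⟩
  rw [← inv_inv g, e, mul_inv_rev, mul_smul, inv_smul_eq]

/-- Applied with `x_j g` in place of `g`, this singles out the only column in which row `j` of the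
image of `a δ_g` can be nonzero. -/
theorem mul_inv_mem_stab_iff (hx : τ.IsReps x) {g : G} {h : τ.stab} {k : Fin (τ.m + 1)}
    (e : g = h * x k)
    (l : Fin (τ.m + 1)) : g * (x l)⁻¹ ∈ τ.stab ↔ k = l := by
  rw [e, mul_assoc, Subgroup.mul_mem_cancel_left _ h.2]
  refine ⟨hx.eq_of_mul_inv_mem, ?_⟩
  rintro rfl
  simp

end IsReps

end Tuple

namespace PartialAction

variable {G : Type u} [Group G] {A : Type v} [NonUnitalCStarAlgebra A] {α : PartialAction G A}
variable {n : ℕ}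

theorem maps_onOrbit_iff {τ : Tuple G n} {g : G} {a b : α.orbitIdeal τ} :
    (α.onOrbit τ).Maps g a b ↔ α.Maps g (a : A) (b : A) :=
  maps_restrictIdeal_iff

theorem maps_onTuple_iff {τ : Tuple G n} {h : τ.stab} {a b : α.tupleIdeal τ.1} :
    (α.onTuple τ).Maps h a b ↔ α.Maps (h : G) (a : A) (b : A) :=
  maps_restrictIdeal_iff (α := α.restrictSubgroup τ.stab)

/-! ### Projections onto the ideals `A_σ` -/

variable (α) in
/-- `p` is the component of `a` in the ideal `A_σ`. -/
def IsProj (σ : Set G) (a p : A) : Prop :=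
  p ∈ α.tupleIdeal σ ∧ ∀ b ∈ α.tupleIdeal σ, a * b = p * b

namespace IsProj

variable {σ : Set G} {a b p q : A}

/-- Testing against `p^* ∈ A_σ` gives `‖p‖² = ‖pp^*‖ = ‖ap^*‖ ≤ ‖a‖‖p‖`. Applied to differences, the
bound yields uniqueness of components and their convergence along limits. -/
theorem norm_le (h : α.IsProj σ a p) : ‖p‖ ≤ ‖a‖ := by
  have h1 : ‖p‖ * ‖p‖ ≤ ‖a‖ * ‖p‖ := by
    rw [← CStarRing.norm_self_mul_star, ← h.2 _ (star_mem h.1), ← norm_star p]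
    exact norm_mul_le _ _
  rcases (norm_nonneg p).eq_or_lt with h0 | h0
  · rw [← h0]; exact norm_nonneg a
  · exact le_of_mul_le_mul_right h1 h0

theorem add (h : α.IsProj σ a p) (h' : α.IsProj σ b q) : α.IsProj σ (a + b) (p + q) :=
  ⟨add_mem h.1 h'.1, fun c hc => by rw [add_mul, add_mul, h.2 c hc, h'.2 c hc]⟩

theorem sub (h : α.IsProj σ a p) (h' : α.IsProj σ b q) : α.IsProj σ (a - b) (p - q) :=
  ⟨sub_mem h.1 h'.1, fun c hc => by rw [sub_mul, sub_mul, h.2 c hc, h'.2 c hc]⟩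

theorem smul (c : ℂ) (h : α.IsProj σ a p) : α.IsProj σ (c • a) (c • p) :=
  ⟨SMulMemClass.smul_mem c h.1, fun b hb => by rw [smul_mul_assoc, smul_mul_assoc, h.2 b hb]⟩

theorem mul (h : α.IsProj σ a p) (h' : α.IsProj σ b q) : α.IsProj σ (a * b) (p * q) :=
  ⟨mul_mem h.1 h'.1, fun c hc => by
    rw [mul_assoc, h'.2 c hc, h.2 _ ((α.tupleIdeal σ).mul_left_mem _ hc), mul_assoc]⟩

theorem unique (h : α.IsProj σ a p) (h' : α.IsProj σ a q) : p = q := by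
  have h1 := (h.sub h').norm_le
  rw [sub_self, norm_zero] at h1
  exact sub_eq_zero.1 (norm_le_zero_iff.1 h1)

/-- The defining condition is one-sided, so this needs an argument. For `y = (a - p)^* b` with `b ∈
A_σ`, also `y ∈ A_σ - p^* b = A_σ`, so `(a - p) y = 0`; hence `y^* y = b^* (a - p) y = 0`. -/
theorem star (h : α.IsProj σ a p) : α.IsProj σ (star a) (star p) := by
  refine ⟨star_mem h.1, fun b hb => sub_eq_zero.1 ?_⟩
  rw [← sub_mul, ← star_sub]
  have h1 : (a - p) * (Star.star (a - p) * b) = 0 := by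
    rw [sub_mul, h.2 _ ((α.tupleIdeal σ).mul_left_mem _ hb), sub_self]
  rw [← CStarRing.star_mul_self_eq_zero_iff, star_mul, star_star, mul_assoc, h1, mul_zero]

/-- The element `pp^* = ap^*` lies in `A_σ ∩ A_g`, which is zero as `g ∉ σ`. -/
theorem eq_zero_of_mem (hα : α.HasDecomposition n) {σ : Tuple G n} {g : G} (hg : g ∉ σ.1)
    (h : α.IsProj σ.1 a p) (ha : a ∈ α.D g) : p = 0 := by
  have h1 : p * Star.star p ∈ α.D g := by
    rw [← h.2 _ (star_mem h.1)]
    exact (α.D g).mul_right_mem _ ha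
  exact (CStarRing.mul_star_self_eq_zero_iff p).1
    (hα.inter_trivial σ g hg _ ((α.tupleIdeal σ.1).mul_right_mem _ h.1) h1)

/-- The hypotheses `g⁻¹ ∈ σ` and `1 ∈ σ` place `A_σ` in the domain of `α_g` and `A_{gσ}` in its
range. The test elements for `b` are then images of test elements for `a`. -/
theorem maps {g : G} (h1 : 1 ∈ σ) (hg : g⁻¹ ∈ σ) (h : α.IsProj σ a p) (hab : α.Maps g a b) :
    ∃ q, α.IsProj (g • σ) b q ∧ α.Maps g p q := by
  obtain ⟨q, hq⟩ := maps_of_mem (h.1 _ hg)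
  refine ⟨q, ⟨hq.mem_tupleIdeal h.1, fun c hc => ?_⟩, hq⟩
  have hcg : c ∈ α.D g := hc g (by rw [Set.mem_smul_set_iff_inv_smul_mem]; simpa using h1)
  have hc' := maps_symm g ⟨c, hcg⟩
  have hcσ := hc'.inv.mem_tupleIdeal hc
  rw [inv_smul_smul] at hcσ
  have h2 := hab.mul hc'
  rw [h.2 _ hcσ] at h2
  exact h2.unique (hq.mul hc')

end IsProj

/-- For `g ∈ ρ` with `g ∉ σ`, the product lies in `A_σ ∩ A_g = {0}`. -/
theorem mul_eq_zero_of_mem (hα : α.HasDecomposition n) {σ ρ : Tuple G n} (h : σ ≠ ρ) {a b : A}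
    (ha : a ∈ α.tupleIdeal σ.1) (hb : b ∈ α.tupleIdeal ρ.1) : a * b = 0 := by
  obtain ⟨g, hg, hg'⟩ := Tuple.exists_mem_notMem h
  exact hα.inter_trivial σ g hg' _ ((α.tupleIdeal σ.1).mul_right_mem _ ha)
    ((α.D g).mul_left_mem _ (hb g hg))

/-- The elements possessing a component in `A_σ` form a subspace, closed because components of a
convergent sequence are Cauchy by `IsProj.norm_le`. It contains every `A_τ`: the component is the
element itself if `τ = σ`, and `0` by orthogonality otherwise. -/
theorem exists_isProj (hα : α.HasDecomposition n) (σ : Tuple G n) (a : A) :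
    ∃ p, α.IsProj σ.1 a p := by
  let S : Submodule ℂ A :=
    { carrier := {a | ∃ p, α.IsProj σ.1 a p}
      zero_mem' := ⟨0, zero_mem _, fun _ _ => rfl⟩
      add_mem' := fun ⟨p, hp⟩ ⟨q, hq⟩ => ⟨p + q, hp.add hq⟩
      smul_mem' := fun c _ ⟨p, hp⟩ => ⟨c • p, hp.smul c⟩ }
  have hS : IsClosed (S : Set A) := by
    refine isClosed_of_closure_subset fun a ha => ?_
    obtain ⟨s, hs, hlim⟩ := mem_closure_iff_seq_limit.1 ha
    choose p hp using hs
    have hc : CauchySeq p := by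
      rw [Metric.cauchySeq_iff]
      intro ε hε
      obtain ⟨N, hN⟩ := Metric.cauchySeq_iff.1 hlim.cauchySeq ε hε
      refine ⟨N, fun i hi j hj => lt_of_le_of_lt ?_ (hN i hi j hj)⟩
      rw [dist_eq_norm, dist_eq_norm]
      exact ((hp i).sub (hp j)).norm_le
    obtain ⟨q, hq⟩ := cauchySeq_tendsto_of_complete hc
    refine ⟨q, (α.tupleIdeal σ.1).isClosed.mem_of_tendsto hq (Eventually.of_forall fun i =>
      (hp i).1), fun b hb => tendsto_nhds_unique (hlim.mul_const b) ?_⟩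
    exact (hq.mul_const b).congr fun i => ((hp i).2 b hb).symm
  refine Submodule.topologicalClosure_minimal _ (iSup_le fun τ b hb => ?_) hS (hα.sum_dense a)
  by_cases h : τ = σ
  · subst h
    exact ⟨b, hb, fun _ _ => rfl⟩
  · exact ⟨0, zero_mem _, fun c hc => by rw [mul_eq_zero_of_mem hα h hb hc, zero_mul]⟩

/-! ### Components transported to the base ideal `A_τ` -/

variable (α) in
/-- `c = α_y(p)`, where `p` is the component of `a` in `A_{y⁻¹τ}`. -/
def IsBase (τ : Tuple G n) (y : G) (a c : A) : Prop :=
  ∃ p, α.IsProj (y⁻¹ • τ.1) a p ∧ α.Maps y p c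

namespace IsBase

variable {τ : Tuple G n} {y : G} {a b c d : A}

theorem mem (h : α.IsBase τ y a c) : c ∈ α.tupleIdeal τ.1 := by
  obtain ⟨p, hp, h⟩ := h
  have := h.mem_tupleIdeal hp.1
  rwa [smul_inv_smul] at this

theorem unique (h : α.IsBase τ y a c) (h' : α.IsBase τ y a d) : c = d := by
  obtain ⟨p, hp, h⟩ := h
  obtain ⟨q, hq, h'⟩ := h'
  rw [hp.unique hq] at h
  exact h.unique h'

theorem add (h : α.IsBase τ y a c) (h' : α.IsBase τ y b d) : α.IsBase τ y (a + b) (c + d) := by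
  obtain ⟨p, hp, h⟩ := h
  obtain ⟨q, hq, h'⟩ := h'
  exact ⟨p + q, hp.add hq, h.add h'⟩

theorem mul (h : α.IsBase τ y a c) (h' : α.IsBase τ y b d) : α.IsBase τ y (a * b) (c * d) := by
  obtain ⟨p, hp, h⟩ := h
  obtain ⟨q, hq, h'⟩ := h'
  exact ⟨p * q, hp.mul hq, h.mul h'⟩

theorem smul (r : ℂ) (h : α.IsBase τ y a c) : α.IsBase τ y (r • a) (r • c) := by
  obtain ⟨p, hp, h⟩ := h
  exact ⟨r • p, hp.smul r, h.smul r⟩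

theorem star (h : α.IsBase τ y a c) : α.IsBase τ y (star a) (star c) := by
  obtain ⟨p, hp, h⟩ := h
  exact ⟨_, hp.star, h.star⟩

theorem eq_zero_of_mem (hα : α.HasDecomposition n) (hy : y ∈ τ.1) {g : G} (hg : y * g ∉ τ.1)
    (h : α.IsBase τ y a c) (ha : a ∈ α.D g) : c = 0 := by
  obtain ⟨p, hp, h⟩ := h
  have hg' : g ∉ (τ.shift y hy).1 := fun h' => hg <| by
    have h2 := Set.mem_smul_set_iff_inv_smul_mem.1 h'
    rwa [inv_inv] at h2
  have h0 := hp.eq_zero_of_mem (σ := τ.shift y hy) hα hg' ha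
  rw [h0] at h
  exact h.unique (maps_zero y)

/-- In the coordinates given by `α_x` and `α_y`, the map `α_g` becomes the action of `k = y g x⁻¹ ∈
H_τ` on `A_τ`. This is what makes the forward map multiplicative and compatible with adjoints. -/
theorem maps {x g : G} {k : τ.stab} (hx : x ∈ τ.1) (hy : y ∈ τ.1) (e : y * g = k * x)
    (ha : α.IsBase τ x a c) (hb : α.IsBase τ y b d) (hab : α.Maps g a b) :
    α.Maps (k : G) c d := by
  obtain ⟨p, hp, hpc⟩ := ha
  obtain ⟨q, hq, hqd⟩ := hb
  have e' : g = y⁻¹ * (k * x) := by rw [← e, inv_mul_cancel_left]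
  -- Here `x g⁻¹ = k⁻¹ y`, which is in `τ` because `k` stabilizes `τ`.
  have hg : g⁻¹ ∈ x⁻¹ • τ.1 := by
    rw [Set.mem_smul_set_iff_inv_smul_mem, e']
    simpa [mul_assoc] using Tuple.stab_mul_mem k⁻¹ hy
  obtain ⟨q', hq', hpq⟩ := hp.maps (τ.shift x hx).2.1 hg hab
  change α.IsProj (g • x⁻¹ • τ.1) b q' at hq'
  -- The shifted set is `g x⁻¹ τ = y⁻¹ k τ = y⁻¹ τ`, so `q'` and `q` are components of `b` in the
  -- same ideal.
  rw [smul_smul, e', mul_assoc, mul_assoc, mul_inv_cancel, mul_one, mul_smul,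
    Tuple.smul_eq] at hq'
  rw [hq'.unique hq] at hpq
  have h := hpc.inv.comp (hpq.comp hqd)
  rwa [e, mul_inv_cancel_right] at h

theorem of_mem (ha : a ∈ α.tupleIdeal (y⁻¹ • τ.1)) (h : α.Maps y a c) : α.IsBase τ y a c :=
  ⟨a, ⟨ha, fun _ _ => rfl⟩, h⟩

end IsBase

theorem exists_isBase (hα : α.HasDecomposition n) (τ : Tuple G n) {y : G} (hy : y ∈ τ.1) (a : A) :
    ∃ c : α.tupleIdeal τ.1, α.IsBase τ y a c := by
  obtain ⟨p, hp⟩ := exists_isProj hα (τ.shift y hy) a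
  obtain ⟨c, hc⟩ := maps_of_mem (hp.1 y⁻¹ (Set.mem_smul_set.2 ⟨1, τ.2.1, mul_one _⟩))
  have h : α.IsBase τ y a c := ⟨p, hp, hc⟩
  exact ⟨⟨c, h.mem⟩, h⟩

/-- The map `a ↦ α_y(p)`, where `p` is the component of `a` in `A_{y⁻¹τ}`. -/
def toBase (hα : α.HasDecomposition n) (τ : Tuple G n) {y : G} (hy : y ∈ τ.1) :
    A →ₗ[ℂ] α.tupleIdeal τ.1 where
  toFun a := (exists_isBase hα τ hy a).choose
  map_add' a b := Subtype.ext <| (exists_isBase hα τ hy (a + b)).choose_spec.unique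
    ((exists_isBase hα τ hy a).choose_spec.add (exists_isBase hα τ hy b).choose_spec)
  map_smul' c a := Subtype.ext <| (exists_isBase hα τ hy (c • a)).choose_spec.unique
    ((exists_isBase hα τ hy a).choose_spec.smul c)

theorem isBase_toBase (hα : α.HasDecomposition n) (τ : Tuple G n) {y : G} (hy : y ∈ τ.1) (a : A) :
    α.IsBase τ y a (toBase hα τ hy a) :=
  (exists_isBase hα τ hy a).choose_spec

/-! ### The homomorphism to matrices -/

section forward

variable (hα : α.HasDecomposition n) {τ : Tuple G n} {x : Fin (τ.m + 1) → G} (hx : τ.IsReps x)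

open Classical in
/-- The `(j, k)` entry of the image of `a δ_g`. -/
def fwdEntry (g : G) (a : α.D g) (j k : Fin (τ.m + 1)) : (α.onTuple τ).Crossed :=
  if h : x j * g * (x k)⁻¹ ∈ τ.stab then
    (α.onTuple τ).delta ⟨_, h⟩ ⟨toBase hα τ (hx.mem j) a, mem_onTuple _ _⟩
  else 0

variable {hα hx}

theorem fwdEntry_of_eq {g : G} (a : α.D g) {j k : Fin (τ.m + 1)} {h : τ.stab}
    (e : x j * g = h * x k) : fwdEntry hα hx g a j k =
      (α.onTuple τ).delta h ⟨toBase hα τ (hx.mem j) a, mem_onTuple _ _⟩ := by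
  have e' : x j * g * (x k)⁻¹ = h := by rw [e, mul_inv_cancel_right]
  rw [fwdEntry, dif_pos (by rw [e']; exact h.2)]
  exact delta_congr (Subtype.ext e') rfl

theorem fwdEntry_of_notMem {g : G} (a : α.D g) {j k : Fin (τ.m + 1)}
    (h : x j * g * (x k)⁻¹ ∉ τ.stab) : fwdEntry hα hx g a j k = 0 := by
  rw [fwdEntry, dif_neg h]

theorem fwdEntry_of_base_eq_zero {g : G} (a : α.D g) {j k : Fin (τ.m + 1)}
    (h : toBase hα τ (hx.mem j) a = 0) : fwdEntry hα hx g a j k = 0 := by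
  by_cases hs : x j * g * (x k)⁻¹ ∈ τ.stab
  · rw [fwdEntry, dif_pos hs]
    refine Eq.trans (delta_congr (a' := 0) rfl ?_) (delta_zero _)
    exact h
  · exact fwdEntry_of_notMem a hs

theorem toBase_eq_zero (hx : τ.IsReps x) {g : G} {a : A} (ha : a ∈ α.D g) {j : Fin (τ.m + 1)}
    (hg : x j * g ∉ τ.1) : toBase hα τ (hx.mem j) a = 0 :=
  Subtype.ext ((isBase_toBase hα τ (hx.mem j) a).eq_zero_of_mem hα (hx.mem j) hg ha)

variable (hα hx) in
/-- The image of `a δ_g` in the matrix algebra. -/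
def fwdₗ (g : G) : α.D g →ₗ[ℂ] α.MatAlg τ where
  toFun a := CStarMatrix.ofMatrix (fwdEntry hα hx g a)
  map_add' a b := by
    ext j k
    change fwdEntry hα hx g (a + b) j k = fwdEntry hα hx g a j k + fwdEntry hα hx g b j k
    by_cases hs : x j * g * (x k)⁻¹ ∈ τ.stab
    · simp only [fwdEntry, dif_pos hs]
      refine Eq.trans ?_ (map_add ((α.onTuple τ).deltaₗ _) ⟨_, _⟩ ⟨_, _⟩)
      exact delta_congr rfl (map_add (toBase hα τ (hx.mem j)) (a : A) (b : A))
    · simp only [fwdEntry, dif_neg hs, add_zero]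
  map_smul' c a := by
    ext j k
    change fwdEntry hα hx g (c • a) j k = c • fwdEntry hα hx g a j k
    by_cases hs : x j * g * (x k)⁻¹ ∈ τ.stab
    · simp only [fwdEntry, dif_pos hs]
      refine Eq.trans ?_ (map_smul ((α.onTuple τ).deltaₗ _) c ⟨_, _⟩)
      exact delta_congr rfl (map_smul (toBase hα τ (hx.mem j)) c (a : A))
    · simp only [fwdEntry, dif_neg hs, smul_zero]

theorem fwdₗ_apply (g : G) (a : α.D g) (j k : Fin (τ.m + 1)) :
    fwdₗ hα hx g a j k = fwdEntry hα hx g a j k := rfl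

/-- Row `j` of the image of `a δ_g` has at most one nonzero entry, in the column `k` with `x_j g ∈
H_τ x_k`. The matrix product thus collapses to one product in `A_τ ⋊ H_τ`, which `IsBase.maps`
evaluates. -/
theorem fwdₗ_mul (g g' : G) (a : α.D g) (b : α.D g') (d : α.D (g * g')) (c : A)
    (hc : α.Maps g c a) (hd : α.Maps g (c * b) d) :
    fwdₗ hα hx g a * fwdₗ hα hx g' b = fwdₗ hα hx (g * g') d := by
  ext j l
  simp only [CStarMatrix.mul_apply, fwdₗ_apply]
  by_cases hg : x j * g ∈ τ.1
  · obtain ⟨h, k, e⟩ := hx.exists_eq hg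
    rw [Finset.sum_eq_single k]
    · rw [fwdEntry_of_eq a e]
      by_cases hs : x k * g' * (x l)⁻¹ ∈ τ.stab
      · obtain ⟨h', hh'⟩ : ∃ h' : τ.stab, (h' : G) = x k * g' * (x l)⁻¹ := ⟨⟨_, hs⟩, rfl⟩
        have e' : x k * g' = h' * x l := by rw [hh', inv_mul_cancel_right]
        have e'' : x j * (g * g') = (h * h' : τ.stab) * x l := by
          rw [Subgroup.coe_mul, mul_assoc, ← e', ← mul_assoc, e, mul_assoc]
        rw [fwdEntry_of_eq b e', fwdEntry_of_eq d e'']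
        have hcb := isBase_toBase hα τ (hx.mem k) c
        have h1 := hcb.maps (hx.mem k) (hx.mem j) e (isBase_toBase hα τ (hx.mem j) a) hc
        have h2 := (hcb.mul (isBase_toBase hα τ (hx.mem k) (b : A))).maps (hx.mem k) (hx.mem j) e
          (isBase_toBase hα τ (hx.mem j) d) hd
        exact delta_mul_delta_of_maps rfl (maps_onTuple_iff.2 h1) (maps_onTuple_iff.2 h2)
      · rw [fwdEntry_of_notMem b hs, mul_zero, fwdEntry_of_notMem]
        rwa [← mul_assoc, e, mul_assoc (h : G), mul_assoc (h : G),
          Subgroup.mul_mem_cancel_left _ h.2]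
    · intro i _ hi
      rw [fwdEntry_of_notMem a, zero_mul]
      rw [hx.mul_inv_mem_stab_iff e]
      exact hi.symm
    · simp
  · rw [fwdEntry_of_base_eq_zero d (toBase_eq_zero hx hd.mem_right hg)]
    refine Finset.sum_eq_zero fun i _ => ?_
    -- If `x_j g ∉ τ`, elements of `A_g` have no component in `A_{x_j⁻¹τ}`. Both `a` and `d` are in
    -- `A_g`, the latter as a value of `α_g`, so row `j` vanishes on both sides.
    rw [fwdEntry_of_base_eq_zero a (toBase_eq_zero hx a.2 hg), zero_mul]

theorem fwdₗ_star (g : G) (a : α.D g) (b : α.D g⁻¹) (h : α.Maps g (b : A) (star (a : A))) :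
    star (fwdₗ hα hx g a) = fwdₗ hα hx g⁻¹ b := by
  ext j k
  simp only [CStarMatrix.star_apply, fwdₗ_apply]
  have e₀ : x j * g⁻¹ * (x k)⁻¹ = (x k * g * (x j)⁻¹)⁻¹ := by group
  by_cases hs : x k * g * (x j)⁻¹ ∈ τ.stab
  · obtain ⟨h', hh'⟩ : ∃ h' : τ.stab, (h' : G) = x k * g * (x j)⁻¹ := ⟨⟨_, hs⟩, rfl⟩
    have e : x k * g = h' * x j := by rw [hh', inv_mul_cancel_right]
    have e' : x j * g⁻¹ = (h'⁻¹ : τ.stab) * x k := by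
      rw [Subgroup.coe_inv, hh', ← e₀, inv_mul_cancel_right]
    rw [fwdEntry_of_eq a e, fwdEntry_of_eq b e']
    refine star_delta_of_maps rfl (maps_onTuple_iff.2 ?_)
    exact (isBase_toBase hα τ (hx.mem j) b).maps (hx.mem j) (hx.mem k) e
      (isBase_toBase hα τ (hx.mem k) a).star h
  · rw [fwdEntry_of_notMem a hs, fwdEntry_of_notMem b, star_zero]
    rwa [e₀, inv_mem_iff]

variable (hα hx) in
/-- The `*`-homomorphism `A ⋊ G → M_{m+1}(A_τ ⋊ H_τ)`. -/
def fwd : α.Crossed →⋆ₙₐ[ℂ] α.MatAlg τ :=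
  Crossed.extendHom (AlgCrossed.liftHom (fwdₗ hα hx) fwdₗ_mul fwdₗ_star)

theorem fwd_delta (g : G) (a : α.D g) : fwd hα hx (α.delta g a) = fwdₗ hα hx g a := by
  rw [fwd, ← AlgCrossed.toCrossed_dl, Crossed.extendHom_toCrossed]
  exact AlgCrossed.liftHom_dl (fwdₗ hα hx) _ _ g a

theorem fwd_genA (j k : Fin (τ.m + 1)) (h : τ.stab) (a : α.tupleIdeal ((x j)⁻¹ • τ.1)) :
    fwd hα hx (α.genA τ hx j k h a) = α.genMat τ x j k h a := by
  rw [genA, fwd_delta]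
  have e : x j * ((x j)⁻¹ * h * x k) = h * x k := by group
  ext i l
  rw [fwdₗ_apply, genMat, CStarMatrix.ofMatrix_apply, Matrix.single_apply]
  by_cases hij : j = i
  · subst hij
    by_cases hkl : k = l
    · subst hkl
      rw [fwdEntry_of_eq _ e, if_pos ⟨rfl, rfl⟩]
      refine delta_congr rfl (Subtype.ext ?_)
      exact (isBase_toBase hα τ (hx.mem j) (a : A)).unique
        (IsBase.of_mem a.2 (maps_act (α := α) (x j) ⟨(a : A), _⟩))
    · rw [fwdEntry_of_notMem, if_neg (by tauto)]
      rwa [hx.mul_inv_mem_stab_iff e]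
  · rw [if_neg (by tauto), fwdEntry_of_base_eq_zero]
    -- In a row `i ≠ j` the entry vanishes by orthogonality: `a` lies in `A_g` for some `g ∈ x_j⁻¹τ`
    -- outside `x_i⁻¹τ`.
    have hne : τ.shift (x i) (hx.mem i) ≠ τ.shift (x j) (hx.mem j) := fun h' =>
      hij (hx.eq_of_smul_eq (congrArg Subtype.val h')).symm
    obtain ⟨g, hg, hg'⟩ := Tuple.exists_mem_notMem hne
    refine toBase_eq_zero hx (a.2 g hg) fun h' => hg' ?_
    refine Set.mem_smul_set_iff_inv_smul_mem.2 ?_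
    rwa [inv_inv]

end forward

end PartialAction

namespace PartialAction

variable {G : Type u} [Group G] {A : Type v} [NonUnitalCStarAlgebra A] {α : PartialAction G A}
variable {n : ℕ}

/-! ### The homomorphism from matrices -/

section backward

variable {τ : Tuple G n}

variable (α τ) in
/-- The map `α_y⁻¹ : A_τ → A_{y⁻¹τ}`, for `y ∈ τ`. -/
def moveFromBase {y : G} (hy : y ∈ τ.1) : α.tupleIdeal τ.1 →ₗ[ℂ] α.tupleIdeal (y⁻¹ • τ.1) where
  toFun a := ⟨(α.act y).symm ⟨a, a.2 y hy⟩,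
    (maps_symm y ⟨(a : A), a.2 y hy⟩).inv.mem_tupleIdeal a.2⟩
  map_add' a b := Subtype.ext <| Maps.symm_eq <|
    (maps_symm y ⟨(a : A), a.2 y hy⟩).add (maps_symm y ⟨(b : A), b.2 y hy⟩)
  map_smul' c a := Subtype.ext <| Maps.symm_eq <| (maps_symm y ⟨(a : A), a.2 y hy⟩).smul c

theorem maps_moveFromBase {y : G} (hy : y ∈ τ.1) (a : α.tupleIdeal τ.1) :
    α.Maps y (α.moveFromBase τ hy a : A) (a : A) :=
  maps_symm y ⟨(a : A), a.2 y hy⟩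

theorem maps_moveToBase (y : G) (a : α.tupleIdeal (y⁻¹ • τ.1)) :
    α.Maps y (a : A) (α.moveToBase τ y a : A) :=
  maps_act (α := α) y ⟨(a : A), _⟩

theorem moveFromBase_moveToBase {y : G} (hy : y ∈ τ.1) (a : α.tupleIdeal (y⁻¹ • τ.1)) :
    α.moveFromBase τ hy (α.moveToBase τ y a) = a :=
  Subtype.ext <| (maps_moveFromBase hy _).unique_left (maps_moveToBase y a)

theorem moveToBase_moveFromBase {y : G} (hy : y ∈ τ.1) (a : α.tupleIdeal τ.1) :
    α.moveToBase τ y (α.moveFromBase τ hy a) = a :=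
  Subtype.ext <| (maps_moveToBase y _).unique (maps_moveFromBase hy a)

theorem maps_moveFromBase_moveFromBase {x y h : G} (hx : x ∈ τ.1) (hy : y ∈ τ.1)
    {c a : α.tupleIdeal τ.1} (hca : α.Maps h (c : A) (a : A)) :
    α.Maps (y⁻¹ * h * x) (α.moveFromBase τ hx c : A) (α.moveFromBase τ hy a : A) := by
  rw [mul_assoc]
  exact ((maps_moveFromBase hx c).comp hca).comp (maps_moveFromBase hy a).inv

theorem mem_orbitIdeal {y : G} (hy : y ∈ τ.1) {a : A} (ha : a ∈ α.tupleIdeal (y⁻¹ • τ.1)) :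
    a ∈ α.orbitIdeal τ :=
  (mem_onOrbit hy (g := 1) (by rwa [mul_one]) ha).1

variable {x : Fin (τ.m + 1) → G} (hx : τ.IsReps x)

/-- The map `a δ_h ↦ α_{x_j}⁻¹(a) δ_{x_j⁻¹ h x_k}`. -/
def bwdₗ (j k : Fin (τ.m + 1)) (h : τ.stab) : (α.onTuple τ).D h →ₗ[ℂ] (α.onOrbit τ).Crossed where
  toFun a := α.genOrbit τ hx j k h (α.moveFromBase τ (hx.mem j) a)
  map_add' a b := by
    refine Eq.trans ?_ (map_add ((α.onOrbit τ).deltaₗ _) ⟨_, _⟩ ⟨_, _⟩)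
    refine delta_congr rfl (Subtype.ext ?_)
    have := map_add (α.moveFromBase τ (hx.mem j)) (a : α.tupleIdeal τ.1) (b : α.tupleIdeal τ.1)
    exact congrArg (fun c : α.tupleIdeal _ => (c : A)) this
  map_smul' c a := by
    refine Eq.trans ?_ (map_smul ((α.onOrbit τ).deltaₗ _) c ⟨_, _⟩)
    refine delta_congr rfl (Subtype.ext ?_)
    have := map_smul (α.moveFromBase τ (hx.mem j)) c (a : α.tupleIdeal τ.1)
    exact congrArg (fun c : α.tupleIdeal _ => (c : A)) this

/-- The map from the algebraic crossed product `A_τ ⋊ H_τ` onto the `(j, k)` corner. -/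
def bwdAlg (j k : Fin (τ.m + 1)) : (α.onTuple τ).AlgCrossed →ₗ[ℂ] (α.onOrbit τ).Crossed :=
  AlgCrossed.liftₗ (bwdₗ hx j k)

variable {hx}

theorem bwdAlg_dl (j k : Fin (τ.m + 1)) (h : τ.stab) (a : (α.onTuple τ).D h) :
    bwdAlg hx j k (AlgCrossed.dl (α.onTuple τ) h a) =
      α.genOrbit τ hx j k h (α.moveFromBase τ (hx.mem j) a) :=
  AlgCrossed.liftₗ_dl (bwdₗ hx j k) h a

/-- This is the relation `e_{j,k} e_{k,l} = e_{j,l}`. On group elements the inner `x_k x_k⁻¹`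
cancels, and on coefficients `α_{x_k}⁻¹` and `α_{x_j}⁻¹` intertwine `α_h` with the action of `x_j⁻¹
h x_k`. -/
theorem bwdAlg_mul (j k l : Fin (τ.m + 1)) (u v : (α.onTuple τ).AlgCrossed) :
    bwdAlg hx j k u * bwdAlg hx k l v = bwdAlg hx j l (u * v) := by
  induction u using AlgCrossed.ind with
  | zero => simp
  | add u u' hu hu' => simp only [add_mul, map_add, hu, hu']
  | of h a =>
  induction v using AlgCrossed.ind with
  | zero => simp
  | add u u' hu hu' => simp only [mul_add, map_add, hu, hu']
  | of h' b =>
  rw [AlgCrossed.dl_mul_dl, bwdAlg_dl, bwdAlg_dl, bwdAlg_dl]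
  have hc := maps_symm (α := α.onTuple τ) h a
  have hd := maps_tw (α := α.onTuple τ) h a (b : α.tupleIdeal τ.1)
  set c := ((α.onTuple τ).act h).symm a
  set d := (α.onTuple τ).tw h a b
  refine delta_mul_delta_of_maps (α := α.onOrbit τ)
    (c := ⟨α.moveFromBase τ (hx.mem k) c, mem_orbitIdeal (hx.mem k) (Subtype.prop _)⟩)
    (by rw [Subgroup.coe_mul]; group)
    (maps_onOrbit_iff.2 (maps_moveFromBase_moveFromBase (hx.mem k) (hx.mem j)
      (maps_onTuple_iff.1 hc)))
    (maps_onOrbit_iff.2 ?_)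
  have h1 := maps_moveFromBase_moveFromBase (hx.mem k) (hx.mem j) (maps_onTuple_iff.1 hd)
  have h2 : (α.moveFromBase τ (hx.mem k) (c * b) : A) =
      α.moveFromBase τ (hx.mem k) c * α.moveFromBase τ (hx.mem k) b :=
    (maps_moveFromBase (hx.mem k) _).unique_left
      ((maps_moveFromBase (hx.mem k) _).mul (maps_moveFromBase (hx.mem k) _))
  rw [h2] at h1
  exact h1

/-- The generator with indices `j, k` has its range in `A_{x_j⁻¹τ}` and its source in `A_{x_k⁻¹τ}`.
The source ideal decides which products of generators vanish. -/
theorem exists_maps_of_mem (hx : τ.IsReps x) (j k : Fin (τ.m + 1)) (h : τ.stab)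
    (a : α.tupleIdeal ((x j)⁻¹ • τ.1)) :
    ∃ c : α.tupleIdeal ((x k)⁻¹ • τ.1), α.Maps ((x j)⁻¹ * h * x k) (c : A) (a : A) := by
  have h0 := maps_symm (α := α.onTuple τ) h ⟨α.moveToBase τ (x j) a, mem_onTuple h _⟩
  have h1 := maps_moveFromBase_moveFromBase (hx.mem k) (hx.mem j) (maps_onTuple_iff.1 h0)
  rw [moveFromBase_moveToBase] at h1
  exact ⟨_, h1⟩

/-- The source ideal `A_{x_k⁻¹τ}` of the first factor is orthogonal to the range ideal `A_{x_l⁻¹τ}`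
of the second. -/
theorem genOrbit_mul_eq_zero (hα : α.HasDecomposition n) {j k l m : Fin (τ.m + 1)} (hkl : k ≠ l)
    (h h' : τ.stab) (a : α.tupleIdeal ((x j)⁻¹ • τ.1)) (b : α.tupleIdeal ((x l)⁻¹ • τ.1)) :
    α.genOrbit τ hx j k h a * α.genOrbit τ hx l m h' b = 0 := by
  obtain ⟨c, hc⟩ := exists_maps_of_mem hx j k h a
  have hne : τ.shift (x k) (hx.mem k) ≠ τ.shift (x l) (hx.mem l) := fun h' =>
    hkl (hx.eq_of_smul_eq (congrArg Subtype.val h'))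
  have h2 : (c : A) * (b : A) = 0 := mul_eq_zero_of_mem hα hne c.2 b.2
  refine Eq.trans (delta_mul_delta_of_maps (α := α.onOrbit τ) (d := 0)
    (c := ⟨c, mem_orbitIdeal (hx.mem k) c.2⟩)
    rfl (maps_onOrbit_iff.2 hc) (maps_onOrbit_iff.2 ?_)) (delta_zero _)
  change α.Maps _ ((c : A) * (b : A)) 0
  rw [h2]
  exact maps_zero _

theorem bwdAlg_mul_eq_zero (hα : α.HasDecomposition n) {j k l m : Fin (τ.m + 1)} (hkl : k ≠ l)
    (u v : (α.onTuple τ).AlgCrossed) : bwdAlg hx j k u * bwdAlg hx l m v = 0 := by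
  induction u using AlgCrossed.ind with
  | zero => simp
  | add u u' hu hu' => simp only [add_mul, map_add, hu, hu', add_zero]
  | of h a =>
  induction v using AlgCrossed.ind with
  | zero => simp
  | add u u' hu hu' => simp only [mul_add, map_add, hu, hu', add_zero]
  | of h' b =>
  rw [bwdAlg_dl, bwdAlg_dl, genOrbit_mul_eq_zero hα hkl]

theorem bwdAlg_star (j k : Fin (τ.m + 1)) (u : (α.onTuple τ).AlgCrossed) :
    star (bwdAlg hx j k u) = bwdAlg hx k j (star u) := by
  induction u using AlgCrossed.ind with
  | zero => simp
  | add u u' hu hu' => simp only [star_add, map_add, hu, hu']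
  | of h a =>
  rw [AlgCrossed.star_dl, bwdAlg_dl, bwdAlg_dl]
  have hb := maps_symm (α := α.onTuple τ) h (star a)
  set b := ((α.onTuple τ).act h).symm (star a)
  refine star_delta_of_maps (α := α.onOrbit τ) (by rw [Subgroup.coe_inv]; group)
    (maps_onOrbit_iff.2 ?_)
  have h1 := maps_moveFromBase_moveFromBase (hx.mem k) (hx.mem j) (maps_onTuple_iff.1 hb)
  have h2 : (α.moveFromBase τ (hx.mem j) (star a : (α.onTuple τ).D h) : A) =
      star (α.moveFromBase τ (hx.mem j) a : A) :=
    (maps_moveFromBase (hx.mem j) _).unique_left (maps_moveFromBase (hx.mem j) _).star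
  rw [h2] at h1
  exact h1

/-- Writing `φ_{j,k}` for `bwdAlg hx j k`, one has `φ_{j,k}(u)^* φ_{j,k}(u) = φ_{k,k}(u^* u)`. The
diagonal map `φ_{k,k}` is a `*`-homomorphism and so contractive by the universal property; the
`C^*`-identity passes the bound to the other corners. -/
theorem norm_bwdAlg_le (j k : Fin (τ.m + 1)) (u : (α.onTuple τ).AlgCrossed) :
    ‖bwdAlg hx j k u‖ ≤ ‖u‖ := by
  let F : (α.onTuple τ).AlgCrossed →⋆ₙₐ[ℂ] (α.onOrbit τ).Crossed :=
    { toFun := bwdAlg hx k k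
      map_zero' := map_zero _
      map_add' := map_add _
      map_smul' := map_smul (bwdAlg hx k k)
      map_mul' := fun u v => (bwdAlg_mul k k k u v).symm
      map_star' := fun u => (bwdAlg_star k k u).symm }
  have h1 : ‖bwdAlg hx j k u‖ * ‖bwdAlg hx j k u‖ ≤ ‖u‖ * ‖u‖ := by
    rw [← CStarRing.norm_star_mul_self, bwdAlg_star, bwdAlg_mul]
    refine (AlgCrossed.norm_hom_le F (star u * u)).trans ?_
    rw [PreCStarAlgebra.norm_star_mul_self', sq]
  nlinarith [norm_nonneg (bwdAlg hx j k u), norm_nonneg u]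

variable (hx) in
/-- The map from `A_τ ⋊ H_τ` onto the `(j, k)` corner. -/
def bwdEntry (j k : Fin (τ.m + 1)) : (α.onTuple τ).Crossed →L[ℂ] (α.onOrbit τ).Crossed :=
  Crossed.extend (bwdAlg hx j k)

theorem bwdEntry_toCrossed (j k : Fin (τ.m + 1)) (u : (α.onTuple τ).AlgCrossed) :
    bwdEntry hx j k (AlgCrossed.toCrossed _ u) = bwdAlg hx j k u :=
  Crossed.extend_toCrossed _ (norm_bwdAlg_le j k) u

theorem bwdEntry_delta (j k : Fin (τ.m + 1)) (h : τ.stab) (a : (α.onTuple τ).D h) :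
    bwdEntry hx j k ((α.onTuple τ).delta h a) =
      α.genOrbit τ hx j k h (α.moveFromBase τ (hx.mem j) a) := by
  rw [← AlgCrossed.toCrossed_dl, bwdEntry_toCrossed, bwdAlg_dl]

theorem bwdEntry_mul (j k l : Fin (τ.m + 1)) (u v : (α.onTuple τ).Crossed) :
    bwdEntry hx j k u * bwdEntry hx k l v = bwdEntry hx j l (u * v) := by
  refine AlgCrossed.denseRange_toCrossed.induction_on₂
    (p := fun u v => bwdEntry hx j k u * bwdEntry hx k l v = bwdEntry hx j l (u * v)) ?_ ?_ u v
  · exact isClosed_eq (by fun_prop) (by fun_prop)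
  · intro u v
    rw [← map_mul, bwdEntry_toCrossed, bwdEntry_toCrossed, bwdEntry_toCrossed, bwdAlg_mul]

theorem bwdEntry_mul_eq_zero (hα : α.HasDecomposition n) {j k l m : Fin (τ.m + 1)} (hkl : k ≠ l)
    (u v : (α.onTuple τ).Crossed) : bwdEntry hx j k u * bwdEntry hx l m v = 0 := by
  refine AlgCrossed.denseRange_toCrossed.induction_on₂
    (p := fun u v => bwdEntry hx j k u * bwdEntry hx l m v = 0) ?_ ?_ u v
  · exact isClosed_eq (by fun_prop) (by fun_prop)
  · intro u v
    rw [bwdEntry_toCrossed, bwdEntry_toCrossed, bwdAlg_mul_eq_zero hα hkl]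

theorem bwdEntry_star (j k : Fin (τ.m + 1)) (u : (α.onTuple τ).Crossed) :
    star (bwdEntry hx j k u) = bwdEntry hx k j (star u) := by
  refine AlgCrossed.denseRange_toCrossed.induction_on
    (p := fun u => star (bwdEntry hx j k u) = bwdEntry hx k j (star u)) u ?_ ?_
  · exact isClosed_eq (by fun_prop) (by fun_prop)
  · intro u
    rw [← map_star (AlgCrossed.toCrossed (α.onTuple τ)), bwdEntry_toCrossed, bwdEntry_toCrossed,
      bwdAlg_star]

variable (hx) in
/-- The `*`-homomorphism `M_{m+1}(A_τ ⋊ H_τ) → A_{G·τ} ⋊ G`. -/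
def bwd (hα : α.HasDecomposition n) : α.MatAlg τ →⋆ₙₐ[ℂ] (α.onOrbit τ).Crossed where
  toFun M := ∑ j, ∑ k, bwdEntry hx j k (M j k)
  map_zero' := by simp
  map_add' M N := by simp [Finset.sum_add_distrib]
  map_smul' c M := by simp [Finset.smul_sum]
  map_mul' M N := by
    simp only [CStarMatrix.mul_apply, map_sum]
    rw [Finset.sum_mul]
    refine Finset.sum_congr rfl fun j _ => ?_
    rw [Finset.sum_comm, Finset.sum_mul]
    refine Finset.sum_congr rfl fun k _ => ?_
    rw [Finset.mul_sum]
    symm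
    -- Of the rows of `N`, only row `k` meets column `k` of `M`; all other products of corners are
    -- zero.
    rw [Finset.sum_eq_single k, Finset.mul_sum]
    · exact Finset.sum_congr rfl fun l _ => bwdEntry_mul j k l _ _
    · intro l _ hl
      rw [Finset.mul_sum]
      exact Finset.sum_eq_zero fun i _ => bwdEntry_mul_eq_zero hα hl.symm _ _
    · simp
  map_star' M := by
    simp only [star_sum, bwdEntry_star, CStarMatrix.star_apply]
    exact Finset.sum_comm

theorem bwd_single (hα : α.HasDecomposition n) (j k : Fin (τ.m + 1)) (u : (α.onTuple τ).Crossed) :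
    bwd hx hα (CStarMatrix.ofMatrix (Matrix.single j k u)) = bwdEntry hx j k u := by
  change ∑ i, ∑ l, bwdEntry hx i l (Matrix.single j k u i l) = _
  rw [Finset.sum_eq_single j, Finset.sum_eq_single k]
  · simp
  · intro l _ hl
    rw [Matrix.single_apply, if_neg (by tauto), map_zero]
  · simp
  · intro i _ hi
    refine Finset.sum_eq_zero fun l _ => ?_
    rw [Matrix.single_apply, if_neg (by tauto), map_zero]
  · simp

theorem bwd_genMat (hα : α.HasDecomposition n) (j k : Fin (τ.m + 1)) (h : τ.stab)
    (a : α.tupleIdeal ((x j)⁻¹ • τ.1)) :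
    bwd hx hα (α.genMat τ x j k h a) = α.genOrbit τ hx j k h a := by
  rw [genMat, bwd_single, bwdEntry_delta, moveFromBase_moveToBase]

theorem inclHom_genOrbit (j k : Fin (τ.m + 1)) (h : τ.stab) (a : α.tupleIdeal ((x j)⁻¹ • τ.1)) :
    α.inclHom (α.orbitIdeal τ) (α.genOrbit τ hx j k h a) = α.genA τ hx j k h a :=
  inclHom_delta _ _

variable (hx) in
/-- The `*`-homomorphism `M_{m+1}(A_τ ⋊ H_τ) → A ⋊ G`. -/
def bwdIncl (hα : α.HasDecomposition n) : α.MatAlg τ →⋆ₙₐ[ℂ] α.Crossed :=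
  (α.inclHom (α.orbitIdeal τ)).comp (bwd hx hα)

theorem bwdIncl_genMat (hα : α.HasDecomposition n) (j k : Fin (τ.m + 1)) (h : τ.stab)
    (a : α.tupleIdeal ((x j)⁻¹ • τ.1)) :
    bwdIncl hx hα (α.genMat τ x j k h a) = α.genA τ hx j k h a :=
  (congrArg (α.inclHom (α.orbitIdeal τ)) (bwd_genMat hα j k h a)).trans
    (inclHom_genOrbit j k h a)

/-- A closed subspace containing the matrices `c v_h ⊗ e_{j,k}` is everything. -/
theorem MatAlg.eq_top_of_genMat_mem (hx : τ.IsReps x) (S : Submodule ℂ (α.MatAlg τ))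
    (hS : IsClosed (S : Set (α.MatAlg τ)))
    (h : ∀ j k h a, α.genMat τ x j k h a ∈ S) : S = ⊤ := by
  have key : ∀ j k (u : (α.onTuple τ).Crossed), CStarMatrix.ofMatrix (Matrix.single j k u) ∈ S := by
    intro j k u
    have hc : Continuous fun u : (α.onTuple τ).Crossed =>
        (CStarMatrix.ofMatrix (Matrix.single j k u) : α.MatAlg τ) := by
      refine CStarMatrix.ofMatrixL.continuous.comp (continuous_matrix fun i l => ?_)
      by_cases hil : j = i ∧ k = l
      · refine continuous_id.congr fun u => ?_
        change _ = Matrix.single j k u i l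
        rw [Matrix.single_apply, if_pos hil, id]
      · refine continuous_const.congr (f := fun _ => 0) fun u => ?_
        change _ = Matrix.single j k u i l
        rw [Matrix.single_apply, if_neg hil]
    refine AlgCrossed.denseRange_toCrossed.induction_on
      (p := fun u => CStarMatrix.ofMatrix (Matrix.single j k u) ∈ S) u (hS.preimage hc) fun u => ?_
    induction u using AlgCrossed.ind with
    | zero => rw [map_zero, Matrix.single_zero]; exact zero_mem S
    | add u v hu hv => rw [map_add, Matrix.single_add]; exact add_mem hu hv
    | of s a =>
      -- Since `x_j ∈ τ`, every element of `A_τ` is `α_{x_j}` of an element of `A_{x_j⁻¹τ}`, so the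
      -- generators give all `c v_s ⊗ e_{j,k}`.
      have := h j k s (α.moveFromBase τ (hx.mem j) a)
      rw [genMat, delta_congr (a' := a) rfl (moveToBase_moveFromBase (hx.mem j) _)] at this
      exact this
  refine eq_top_iff.2 fun M _ => ?_
  have hM : M = ∑ j, ∑ k, CStarMatrix.ofMatrix (Matrix.single j k (M j k)) :=
    Matrix.matrix_eq_sum_single M
  rw [hM]
  exact sum_mem fun j _ => sum_mem fun k _ => key j k _

theorem fwd_bwdIncl (hα : α.HasDecomposition n) (M : α.MatAlg τ) :
    fwd hα hx (bwdIncl hx hα M) = M := by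
  let F : α.MatAlg τ →⋆ₙₐ[ℂ] α.MatAlg τ := (fwd hα hx).comp (bwdIncl hx hα)
  have hF : Continuous F := map_continuous F
  have h := MatAlg.eq_top_of_genMat_mem hx
    (LinearMap.eqLocus (F : α.MatAlg τ →ₗ[ℂ] α.MatAlg τ) LinearMap.id)
    (isClosed_eq hF continuous_id) fun j k h a => by
      change fwd hα hx (bwdIncl hx hα (α.genMat τ x j k h a)) = α.genMat τ x j k h a
      rw [bwdIncl_genMat, fwd_genA]
  have hM : M ∈ (⊤ : Submodule ℂ (α.MatAlg τ)) := Submodule.mem_top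
  rw [← h] at hM
  exact hM

end backward

end PartialAction

/-! ### Auxiliary facts on homomorphisms, direct sums and orbits -/

theorem NonUnitalStarAlgHom.continuous_of_cstar {F : Type w} {B : Type u} {C : Type v}
    [NonUnitalCStarAlgebra B] [NonUnitalCStarAlgebra C] [FunLike F B C]
    [NonUnitalAlgHomClass F ℂ B C] [StarHomClass F B C] (f : F) : Continuous f :=
  AddMonoidHomClass.continuous_of_bound f 1 fun b => by
    rw [one_mul]
    exact NonUnitalStarAlgHom.norm_apply_le f b

theorem StarAlgEquiv.eq_of_eqOn_dense {B : Type u} {C : Type v} [NonUnitalCStarAlgebra B]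
    [NonUnitalCStarAlgebra C] {f g : B ≃⋆ₐ[ℂ] C} {T : Set B}
    (hT : ∀ S : Submodule ℂ B, IsClosed (S : Set B) → T ⊆ S → S = ⊤)
    (h : ∀ b ∈ T, f b = g b) : f = g := by
  have hS := hT (LinearMap.eqLocus (f : B →ₗ[ℂ] C) (g : B →ₗ[ℂ] C))
    (isClosed_eq (NonUnitalStarAlgHom.continuous_of_cstar f)
      (NonUnitalStarAlgHom.continuous_of_cstar g)) h
  refine DFunLike.ext _ _ fun b => ?_
  have hb : b ∈ (⊤ : Submodule ℂ B) := Submodule.mem_top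
  rw [← hS] at hb
  exact hb

theorem NonUnitalStarAlgHom.isClosed_preimage {B : Type u} {C : Type v} [NonUnitalCStarAlgebra B]
    [NonUnitalCStarAlgebra C] (f : B →⋆ₙₐ[ℂ] C) {S : Set C} (hS : IsClosed S) :
    IsClosed (f ⁻¹' S) :=
  hS.preimage (continuous_of_cstar f)

theorem C0Sum.single_apply_self {ι : Type u} (B : ι → Type v) [∀ i, NonUnitalCStarAlgebra (B i)]
    (i : ι) (b : B i) : (C0Sum.single B i b).1 i = b := by
  classical
  exact lp.single_apply_self ∞ i b

theorem C0Sum.single_apply_of_ne {ι : Type u} (B : ι → Type v)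
    [∀ i, NonUnitalCStarAlgebra (B i)] {i j : ι} (h : j ≠ i) (b : B i) :
    (C0Sum.single B i b).1 j = 0 := by
  classical
  exact lp.single_apply_ne ∞ i b h

theorem Tuple.orbit_shift {G : Type u} [Group G] {n : ℕ} (τ : Tuple G n) {y : G} (hy : y ∈ τ.1) :
    (τ.shift y hy).orbit = τ.orbit :=
  Quotient.sound ⟨y, Set.mem_smul_set.2 ⟨1, τ.2.1, mul_one _⟩, smul_inv_smul _ _⟩

namespace PartialAction

variable {G : Type u} [Group G] {A : Type v} [NonUnitalCStarAlgebra A] {α : PartialAction G A}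
variable {n : ℕ}

/-! ### The isomorphism for a single orbit -/

section orbit

variable {τ : Tuple G n} {x : Fin (τ.m + 1) → G}

/-- This explains why the generators suffice. After rewriting `g'τ` as `x_j⁻¹τ`, a nonzero element
of `A_{x_j⁻¹τ} ∩ A_g` forces `x_j g ∈ τ`, so `g` has the form `x_j⁻¹ h x_k`. -/
theorem eq_zero_or_exists_eq (hα : α.HasDecomposition n) (hx : τ.IsReps x) {g' g : G}
    (hg' : g'⁻¹ ∈ τ.1) {c : A} (hc : c ∈ α.tupleIdeal (g' • τ.1)) (hcg : c ∈ α.D g) :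
    c = 0 ∨ ∃ (j k : Fin (τ.m + 1)) (h : τ.stab), g = (x j)⁻¹ * h * x k ∧
      c ∈ α.tupleIdeal ((x j)⁻¹ • τ.1) := by
  obtain ⟨j, hj⟩ := hx.exists_smul_eq hg'
  rw [hj] at hc
  by_cases hg : x j * g ∈ τ.1
  · obtain ⟨h, k, e⟩ := hx.exists_eq hg
    exact Or.inr ⟨j, k, h, by rw [mul_assoc, ← e, inv_mul_cancel_left], hc⟩
  · refine Or.inl (hα.inter_trivial (τ.shift (x j) (hx.mem j)) g (fun h => hg ?_) c hc hcg)
    have h2 := Set.mem_smul_set_iff_inv_smul_mem.1 h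
    rwa [inv_inv] at h2

/-- A closed subspace of `A_{G·τ} ⋊ G` containing the generators is everything. -/
theorem onOrbit_eq_top_of_genOrbit_mem (hα : α.HasDecomposition n) (hx : τ.IsReps x)
    (S : Submodule ℂ (α.onOrbit τ).Crossed) (hS : IsClosed (S : Set (α.onOrbit τ).Crossed))
    (h : ∀ j k h a, α.genOrbit τ hx j k h a ∈ S) : S = ⊤ := by
  let T : Set (α.orbitIdeal τ) := {b | ∃ g : G, g⁻¹ ∈ τ.1 ∧ (b : A) ∈ α.tupleIdeal (g • τ.1)}
  refine Crossed.eq_top_of_delta_mem S hS T ?_ ?_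
  · let i : α.orbitIdeal τ →ₗ[ℂ] A :=
      { toFun := Subtype.val, map_add' := fun _ _ => rfl, map_smul' := fun _ _ => rfl }
    -- The sum defining `A_{G·τ}` is closed up in `A`, whereas density of `T` is needed inside
    -- `A_{G·τ}`. The closed embedding of the ideal into `A` lets the two closures be compared.
    have hW : IsClosed (((Submodule.span ℂ T).topologicalClosure.map i : Submodule ℂ A) : Set A) :=
      (α.orbitIdeal τ).isClosed.isClosedEmbedding_subtypeVal.isClosedMap _
        (Submodule.isClosed_topologicalClosure _)
    intro a
    have ha : (a : A) ∈ (Submodule.span ℂ T).topologicalClosure.map i := by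
      refine Submodule.topologicalClosure_minimal _ (iSup_le fun g b hb => ?_) hW a.2
      have hbI : b ∈ α.orbitIdeal τ := ClosedIdeal.mem_closedSum
        (I := fun g : {g : G // g⁻¹ ∈ τ.1} => α.tupleIdeal (g.1 • τ.1)) g hb
      exact ⟨⟨b, hbI⟩, subset_closure (Submodule.subset_span ⟨g.1, g.2, hb⟩), rfl⟩
    obtain ⟨b, hb, e⟩ := ha
    rwa [← Subtype.ext (a1 := b) (a2 := a) e]
  · rintro g a b ⟨g', hg', hb⟩
    have hab := (α.tupleIdeal (g' • τ.1)).mul_left_mem ((a : α.orbitIdeal τ) : A) hb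
    have hg := (α.D g).mul_right_mem (b : A) (mem_D_of_mem_restrictD a.2)
    rcases eq_zero_or_exists_eq hα hx hg' hab hg with h0 | ⟨j, k, h', rfl, hc⟩
    · rw [delta_congr (a' := 0) rfl (Subtype.ext h0), delta_zero]
      exact zero_mem S
    · exact h j k h' ⟨_, hc⟩

/-- The left inverse makes `fwd` injective on the image of `A_{G·τ} ⋊ G`, and shows incidentally
that `inclHom` is injective for this ideal. -/
theorem bwd_fwd_inclHom (hα : α.HasDecomposition n) (hx : τ.IsReps x)
    (u : (α.onOrbit τ).Crossed) :
    bwd hx hα (fwd hα hx (α.inclHom (α.orbitIdeal τ) u)) = u := by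
  let F : (α.onOrbit τ).Crossed →⋆ₙₐ[ℂ] (α.onOrbit τ).Crossed :=
    (bwd hx hα).comp ((fwd hα hx).comp (α.inclHom (α.orbitIdeal τ)))
  have hF : Continuous F := map_continuous F
  have h := onOrbit_eq_top_of_genOrbit_mem hα hx
    (LinearMap.eqLocus (F : (α.onOrbit τ).Crossed →ₗ[ℂ] (α.onOrbit τ).Crossed) LinearMap.id)
    (isClosed_eq hF continuous_id) fun j k h a => by
      change bwd hx hα (fwd hα hx (α.inclHom (α.orbitIdeal τ) (α.genOrbit τ hx j k h a))) =
        α.genOrbit τ hx j k h a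
      rw [inclHom_genOrbit, fwd_genA, bwd_genMat]
  have hu : u ∈ (⊤ : Submodule ℂ (α.onOrbit τ).Crossed) := Submodule.mem_top
  rw [← h] at hu
  exact hu

/-- The isomorphism `A_{G·τ} ⋊ G ≃ M_{m+1}(A_τ ⋊ H_τ)`. -/
def orbitEquiv (hα : α.HasDecomposition n) (hx : τ.IsReps x)
    : (α.onOrbit τ).Crossed ≃⋆ₐ[ℂ] α.MatAlg τ :=
  StarAlgEquiv.ofBijective ((fwd hα hx).comp (α.inclHom (α.orbitIdeal τ)))
    ⟨Function.LeftInverse.injective (g := bwd hx hα) (bwd_fwd_inclHom hα hx),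
      Function.RightInverse.surjective (g := bwd hx hα) (fwd_bwdIncl hα)⟩

theorem orbitEquiv_genOrbit (hα : α.HasDecomposition n) (hx : τ.IsReps x)
    (j k : Fin (τ.m + 1)) (h : τ.stab)
    (a : α.tupleIdeal ((x j)⁻¹ • τ.1)) :
    orbitEquiv hα hx (α.genOrbit τ hx j k h a) = α.genMat τ x j k h a := by
  change fwd hα hx (α.inclHom (α.orbitIdeal τ) (α.genOrbit τ hx j k h a)) = _
  rw [inclHom_genOrbit, fwd_genA]

theorem existsUnique_orbitEquiv (hα : α.HasDecomposition n) (hx : τ.IsReps x)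
    : ∃! ψ : (α.onOrbit τ).Crossed ≃⋆ₐ[ℂ] α.MatAlg τ,
    ∀ (j k : Fin (τ.m + 1)) (h : τ.stab) (a : α.tupleIdeal ((x j)⁻¹ • τ.1)),
      ψ (α.genOrbit τ hx j k h a) = α.genMat τ x j k h a := by
  refine ⟨orbitEquiv hα hx, orbitEquiv_genOrbit hα hx, fun ψ hψ => ?_⟩
  refine StarAlgEquiv.eq_of_eqOn_dense (T := {u | ∃ j k h a, u = α.genOrbit τ hx j k h a})
    (fun S hS hT => onOrbit_eq_top_of_genOrbit_mem hα hx S hS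
      fun j k h a => hT ⟨j, k, h, a, rfl⟩) ?_
  rintro _ ⟨j, k, h, a, rfl⟩
  exact (hψ j k h a).trans (orbitEquiv_genOrbit hα hx j k h a).symm

end orbit

/-! ### The isomorphism onto the direct sum -/

section sum

variable {s : Tuple.OrbitSpace G n → Tuple G n} {x : ∀ z, Fin ((s z).m + 1) → G}

/-- A closed subspace of `A ⋊ G` containing the generators is everything. -/
theorem crossed_eq_top_of_genA_mem (hα : α.HasDecomposition n) (hs : ∀ z, (s z).orbit = z)
    (hx : ∀ z, (s z).IsReps (x z)) (S : Submodule ℂ α.Crossed)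
    (hS : IsClosed (S : Set α.Crossed))
    (h : ∀ z j k h a, α.genA (s z) (hx z) j k h a ∈ S) : S = ⊤ := by
  refine Crossed.eq_top_of_delta_mem S hS {b | ∃ σ : Tuple G n, b ∈ α.tupleIdeal σ.1} ?_ ?_
  · intro a
    refine Submodule.topologicalClosure_mono (iSup_le fun σ b hb => ?_) (hα.sum_dense a)
    exact Submodule.subset_span ⟨σ, hb⟩
  · rintro g a b ⟨σ, hb⟩
    have hab := (α.tupleIdeal σ.1).mul_left_mem (a : A) hb
    have hg := (α.D g).mul_right_mem b a.2
    obtain ⟨g', hg', e⟩ : Tuple.SameOrbit (s σ.orbit) σ := Quotient.exact (hs σ.orbit)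
    rw [← e] at hab
    rcases eq_zero_or_exists_eq hα (hx σ.orbit) hg' hab hg with h0 | ⟨j, k, h', rfl, hc⟩
    · rw [delta_congr (a' := 0) rfl h0, delta_zero]
      exact zero_mem S
    · exact h σ.orbit j k h' ⟨_, hc⟩

/-- The source set of the first generator and the range set of the second lie in different orbits,
hence are distinct and have orthogonal ideals. -/
theorem genA_mul_genA_eq_zero (hα : α.HasDecomposition n) (hs : ∀ z, (s z).orbit = z)
    (hx : ∀ z, (s z).IsReps (x z)) {w z : Tuple.OrbitSpace G n} (hwz : w ≠ z)
    (j k : Fin ((s w).m + 1)) (h : (s w).stab) (a : α.tupleIdeal ((x w j)⁻¹ • (s w).1))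
    (l m : Fin ((s z).m + 1)) (h' : (s z).stab) (b : α.tupleIdeal ((x z l)⁻¹ • (s z).1)) :
    α.genA (s w) (hx w) j k h a * α.genA (s z) (hx z) l m h' b = 0 := by
  obtain ⟨c, hc⟩ := exists_maps_of_mem (hx w) j k h a
  have hne : (s w).shift (x w k) ((hx w).mem k) ≠ (s z).shift (x z l) ((hx z).mem l) := fun e =>
    hwz <| by
      rw [← hs w, ← hs z, ← Tuple.orbit_shift (s w) ((hx w).mem k), e, Tuple.orbit_shift]
  have h2 : (c : A) * (b : A) = 0 := mul_eq_zero_of_mem hα hne c.2 b.2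
  refine Eq.trans (delta_mul_delta_of_maps (d := 0) rfl hc ?_) (delta_zero _)
  rw [h2]
  exact maps_zero _

theorem bwdIncl_mul_bwdIncl_eq_zero (hα : α.HasDecomposition n) (hs : ∀ z, (s z).orbit = z)
    (hx : ∀ z, (s z).IsReps (x z)) {w z : Tuple.OrbitSpace G n} (hwz : w ≠ z)
    (M : α.MatAlg (s w)) (N : α.MatAlg (s z)) :
    bwdIncl (hx w) hα M * bwdIncl (hx z) hα N = 0 := by
  have hcw : Continuous (bwdIncl (hx w) hα) := map_continuous _
  have hcz : Continuous (bwdIncl (hx z) hα) := map_continuous _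
  have key : ∀ j k h a, α.genA (s w) (hx w) j k h a * bwdIncl (hx z) hα N = 0 := by
    intro j k h a
    have := MatAlg.eq_top_of_genMat_mem (hx z)
      (LinearMap.ker (LinearMap.mulLeft ℂ (α.genA (s w) (hx w) j k h a) ∘ₗ
        (bwdIncl (hx z) hα : α.MatAlg (s z) →ₗ[ℂ] α.Crossed)))
      (isClosed_eq (hcz.const_mul _) continuous_const) fun l m h' b => by
        change α.genA (s w) (hx w) j k h a * bwdIncl (hx z) hα (α.genMat (s z) (x z) l m h' b) = 0
        rw [bwdIncl_genMat, genA_mul_genA_eq_zero hα hs hx hwz]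
    have hN : N ∈ (⊤ : Submodule ℂ (α.MatAlg (s z))) := Submodule.mem_top
    rw [← this] at hN
    exact hN
  have := MatAlg.eq_top_of_genMat_mem (hx w)
    (LinearMap.ker (LinearMap.mulRight ℂ (bwdIncl (hx z) hα N) ∘ₗ
      (bwdIncl (hx w) hα : α.MatAlg (s w) →ₗ[ℂ] α.Crossed)))
    (isClosed_eq (hcw.mul_const _) continuous_const) fun j k h a => by
      change bwdIncl (hx w) hα (α.genMat (s w) (x w) j k h a) * bwdIncl (hx z) hα N = 0
      rw [bwdIncl_genMat, key]
  have hM : M ∈ (⊤ : Submodule ℂ (α.MatAlg (s w))) := Submodule.mem_top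
  rw [← this] at hM
  exact hM

/-- Since `fwd` at `z` is onto, `N^*` can be written as the image of an element from the summand
`z`; then `NN^*` is the image of a product of elements from different summands, which is zero. -/
theorem fwd_bwdIncl_of_ne (hα : α.HasDecomposition n) (hs : ∀ z, (s z).orbit = z)
    (hx : ∀ z, (s z).IsReps (x z)) {w z : Tuple.OrbitSpace G n} (hwz : w ≠ z) (M : α.MatAlg (s w)) :
    fwd hα (hx z) (bwdIncl (hx w) hα M) = 0 := by
  set N := fwd hα (hx z) (bwdIncl (hx w) hα M)
  have h1 : N * star N = 0 := by
    rw [← fwd_bwdIncl (hx := hx z) hα (star N), ← map_mul,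
      bwdIncl_mul_bwdIncl_eq_zero hα hs hx hwz, map_zero]
  exact (CStarRing.mul_star_self_eq_zero_iff N).1 h1

/-- The copy of the matrix algebra of `z` in `A ⋊ G` absorbs multiplication from the left, and `fwd`
records how `u` acts on it. On a generator `u` of the same orbit this is multiplicativity; on one of
another orbit both sides vanish. -/
theorem mul_bwdIncl (hα : α.HasDecomposition n) (hs : ∀ z, (s z).orbit = z)
    (hx : ∀ z, (s z).IsReps (x z)) (z : Tuple.OrbitSpace G n) (u : α.Crossed) (M : α.MatAlg (s z)) :
    u * bwdIncl (hx z) hα M = bwdIncl (hx z) hα (fwd hα (hx z) u * M) := by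
  let F : α.Crossed →⋆ₙₐ[ℂ] α.Crossed := (bwdIncl (hx z) hα).comp (fwd hα (hx z))
  have hF : Continuous F := map_continuous F
  have := crossed_eq_top_of_genA_mem hα hs hx
    (LinearMap.eqLocus (LinearMap.mulRight ℂ (bwdIncl (hx z) hα M))
      (LinearMap.mulRight ℂ (bwdIncl (hx z) hα M) ∘ₗ (F : α.Crossed →ₗ[ℂ] α.Crossed)))
    (isClosed_eq (continuous_id.mul_const _) (hF.mul_const _)) fun w j k h a => by
      change α.genA (s w) (hx w) j k h a * bwdIncl (hx z) hα M =
        bwdIncl (hx z) hα (fwd hα (hx z) (α.genA (s w) (hx w) j k h a)) * bwdIncl (hx z) hα M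
      rcases eq_or_ne w z with rfl | hwz
      · rw [fwd_genA, bwdIncl_genMat]
      · rw [← bwdIncl_genMat hα, bwdIncl_mul_bwdIncl_eq_zero hα hs hx hwz,
          fwd_bwdIncl_of_ne hα hs hx hwz, map_zero, zero_mul]
  have hu : u ∈ (⊤ : Submodule ℂ α.Crossed) := Submodule.mem_top
  rw [← this] at hu
  rw [map_mul]
  exact hu

/-- By `mul_bwdIncl`, `u` annihilates every generator from the left, hence all of `A ⋊ G`, in
particular `u^*`; so `uu^* = 0`. -/
theorem eq_zero_of_forall_fwd_eq_zero (hα : α.HasDecomposition n) (hs : ∀ z, (s z).orbit = z)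
    (hx : ∀ z, (s z).IsReps (x z)) {u : α.Crossed} (hu : ∀ z, fwd hα (hx z) u = 0) : u = 0 := by
  have := crossed_eq_top_of_genA_mem hα hs hx (LinearMap.ker (LinearMap.mulLeft ℂ u))
    (isClosed_eq (continuous_id.const_mul _) continuous_const) fun z j k h a => by
      change u * α.genA (s z) (hx z) j k h a = 0
      rw [← bwdIncl_genMat hα, mul_bwdIncl hα hs hx, hu, zero_mul, map_zero]
  have h : star u ∈ (⊤ : Submodule ℂ α.Crossed) := Submodule.mem_top
  rw [← this] at h
  exact (CStarRing.mul_star_self_eq_zero_iff u).1 h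

/-- The family of all maps `A ⋊ G → M_{m+1}(A_τ ⋊ H_τ)`, as a map to the `ℓ^∞`-sum. -/
def sumFwd (hα : α.HasDecomposition n) (hx : ∀ z, (s z).IsReps (x z)) :
    α.Crossed →⋆ₙₐ[ℂ] lp (fun z => α.MatAlg (s z)) ∞ where
  toFun u := ⟨fun z => fwd hα (hx z) u, memℓp_infty ⟨‖u‖, by
    rintro _ ⟨z, rfl⟩
    exact NonUnitalStarAlgHom.norm_apply_le (fwd hα (hx z)) u⟩⟩
  map_zero' := lp.ext (funext fun z => map_zero (fwd hα (hx z)))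
  map_add' u v := lp.ext (funext fun z => map_add (fwd hα (hx z)) u v)
  map_smul' c u := lp.ext (funext fun z => map_smul (fwd hα (hx z)) c u)
  map_mul' u v := lp.ext (funext fun z => map_mul (fwd hα (hx z)) u v)
  map_star' u := lp.ext (funext fun z => map_star (fwd hα (hx z)) u)

theorem sumFwd_apply (hα : α.HasDecomposition n) (hx : ∀ z, (s z).IsReps (x z))
    (u : α.Crossed) (z : Tuple.OrbitSpace G n) :
    sumFwd hα hx u z = fwd hα (hx z) u := rfl

theorem sumFwd_bwdIncl (hα : α.HasDecomposition n) (hs : ∀ z, (s z).orbit = z)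
    (hx : ∀ z, (s z).IsReps (x z)) (z : Tuple.OrbitSpace G n) (M : α.MatAlg (s z)) :
    sumFwd hα hx (bwdIncl (hx z) hα M) = C0Sum.single (fun z => α.MatAlg (s z)) z M := by
  refine lp.ext (funext fun w => ?_)
  rw [sumFwd_apply]
  rcases eq_or_ne w z with rfl | hwz
  · rw [fwd_bwdIncl]
    exact (C0Sum.single_apply_self (fun z => α.MatAlg (s z)) w M).symm
  · rw [fwd_bwdIncl_of_ne hα hs hx hwz.symm]
    exact (C0Sum.single_apply_of_ne (fun z => α.MatAlg (s z)) hwz M).symm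

/-- Each generator is sent to a single summand, and the `c_0`-sum is closed in the `ℓ^∞`-sum. -/
theorem sumFwd_mem (hα : α.HasDecomposition n) (hs : ∀ z, (s z).orbit = z)
    (hx : ∀ z, (s z).IsReps (x z)) (u : α.Crossed) :
    sumFwd hα hx u ∈ C0Sum fun z => α.MatAlg (s z) := by
  have := crossed_eq_top_of_genA_mem hα hs hx
    ((C0Sum fun z => α.MatAlg (s z)).toSubmodule.comap
      (sumFwd hα hx : α.Crossed →ₗ[ℂ] lp (fun z => α.MatAlg (s z)) ∞))
    (NonUnitalStarAlgHom.isClosed_preimage (sumFwd hα hx) (C0Sum.isClosed _)) fun z j k h a => by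
      change sumFwd hα hx _ ∈ C0Sum fun z => α.MatAlg (s z)
      rw [← bwdIncl_genMat hα, sumFwd_bwdIncl hα hs hx]
      exact Subtype.prop _
  have hu : u ∈ (⊤ : Submodule ℂ α.Crossed) := Submodule.mem_top
  rw [← this] at hu
  exact hu

/-- The map from `A ⋊ G` to the direct sum. -/
def sumHom (hα : α.HasDecomposition n) (hs : ∀ z, (s z).orbit = z)
    (hx : ∀ z, (s z).IsReps (x z)) :
    α.Crossed →⋆ₙₐ[ℂ] C0Sum fun z => α.MatAlg (s z) :=
  NonUnitalStarAlgHom.codRestrict (sumFwd hα hx) _ (sumFwd_mem hα hs hx)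

theorem coe_sumHom (hα : α.HasDecomposition n) (hs : ∀ z, (s z).orbit = z)
    (hx : ∀ z, (s z).IsReps (x z)) (u : α.Crossed) (z : Tuple.OrbitSpace G n) :
    (sumHom hα hs hx u).1 z = fwd hα (hx z) u := rfl

theorem sumHom_genA (hα : α.HasDecomposition n) (hs : ∀ z, (s z).orbit = z)
    (hx : ∀ z, (s z).IsReps (x z)) (z : Tuple.OrbitSpace G n) (j k : Fin ((s z).m + 1))
    (h : (s z).stab) (a : α.tupleIdeal ((x z j)⁻¹ • (s z).1)) :
    sumHom hα hs hx (α.genA (s z) (hx z) j k h a) =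
      C0Sum.single (fun z => α.MatAlg (s z)) z (α.genMat (s z) (x z) j k h a) := by
  rw [← bwdIncl_genMat hα]
  exact Subtype.ext (sumFwd_bwdIncl hα hs hx z _)

theorem sumHom_injective (hα : α.HasDecomposition n) (hs : ∀ z, (s z).orbit = z)
    (hx : ∀ z, (s z).IsReps (x z)) : Function.Injective (sumHom hα hs hx) := by
  refine (injective_iff_map_eq_zero _).2 fun u hu => eq_zero_of_forall_fwd_eq_zero hα hs hx
    fun z => ?_
  rw [← coe_sumHom hα hs hx, hu]
  rfl

/-- An injective `*`-homomorphism of `C^*`-algebras is isometric, so the range is closed and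
approximating each `f` is enough. -/
theorem sumHom_surjective (hα : α.HasDecomposition n) (hs : ∀ z, (s z).orbit = z)
    (hx : ∀ z, (s z).IsReps (x z)) : Function.Surjective (sumHom hα hs hx) := by
  have hcl : IsClosed (Set.range (sumHom hα hs hx)) :=
    (NonUnitalStarAlgHom.isometry (sumHom hα hs hx)
      (sumHom_injective hα hs hx)).isClosedEmbedding.isClosed_range
  intro f
  refine hcl.closure_subset (Metric.mem_closure_iff.2 fun ε hε => ?_)
  have hf : Tendsto (fun z => ‖f.1 z‖) cofinite (𝓝 0) := f.2
  -- The approximant is `f` cut off to the finitely many `z` with `‖f z‖ ≥ ε/2`. The supremum of the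
  -- remaining norms is only known to be at most `ε/2`, hence the halving to obtain a distance
  -- strictly below `ε`.
  have hfin : {z | ¬ ‖f.1 z‖ < ε / 2}.Finite := hf.eventually_lt_const (half_pos hε)
  refine ⟨_, ⟨∑ z ∈ hfin.toFinset, bwdIncl (hx z) hα (f.1 z), rfl⟩, ?_⟩
  rw [dist_eq_norm]
  refine lt_of_le_of_lt ?_ (half_lt_self hε)
  refine lp.norm_le_of_forall_le (half_pos hε).le fun w => ?_
  change ‖f.1 w - fwd hα (hx w) (∑ z ∈ hfin.toFinset, bwdIncl (hx z) hα (f.1 z))‖ ≤ ε / 2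
  rw [map_sum]
  by_cases hw : ‖f.1 w‖ < ε / 2
  · rw [Finset.sum_eq_zero, sub_zero]
    · exact hw.le
    · intro z hz
      refine fwd_bwdIncl_of_ne hα hs hx ?_ _
      rintro rfl
      exact hfin.mem_toFinset.1 hz hw
  · rw [Finset.sum_eq_single w, fwd_bwdIncl, sub_self, norm_zero]
    · exact (half_pos hε).le
    · exact fun z _ hz => fwd_bwdIncl_of_ne hα hs hx hz _
    · exact fun h => absurd (hfin.mem_toFinset.2 hw) h

theorem existsUnique_sumEquiv (hα : α.HasDecomposition n) (hs : ∀ z, (s z).orbit = z)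
    (hx : ∀ z, (s z).IsReps (x z)) :
    ∃! Ψ : α.Crossed ≃⋆ₐ[ℂ] C0Sum fun z => α.MatAlg (s z),
      ∀ (z : Tuple.OrbitSpace G n) (j k : Fin ((s z).m + 1)) (h : (s z).stab)
        (a : α.tupleIdeal ((x z j)⁻¹ • (s z).1)),
        Ψ (α.genA (s z) (hx z) j k h a) =
          C0Sum.single (fun z => α.MatAlg (s z)) z (α.genMat (s z) (x z) j k h a) := by
  let φ : α.Crossed ≃⋆ₐ[ℂ] C0Sum fun z => α.MatAlg (s z) :=
    StarAlgEquiv.ofBijective (sumHom hα hs hx)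
      ⟨sumHom_injective hα hs hx, sumHom_surjective hα hs hx⟩
  refine ⟨φ, sumHom_genA hα hs hx, fun ψ hψ => ?_⟩
  refine StarAlgEquiv.eq_of_eqOn_dense (T := {u | ∃ z j k h a, u = α.genA (s z) (hx z) j k h a})
    (fun S hS hT => crossed_eq_top_of_genA_mem hα hs hx S hS
      fun z j k h a => hT ⟨z, j, k, h, a, rfl⟩) ?_
  rintro _ ⟨z, j, k, h, a, rfl⟩
  exact (hψ z j k h a).trans (sumHom_genA hα hs hx z j k h a).symm

end sum

end PartialAction

end PartialCrossed

end

theorem mainTheorem2 {G : Type*} [Group G] {A : Type*} [NonUnitalCStarAlgebra A] (n : ℕ)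
    (α : PartialAction G A) (hα : α.HasDecomposition n) :
    (∀ τ : Tuple G n, (∃ x : Fin (τ.m + 1) → G, τ.IsReps x) ∧
      ∀ (x : Fin (τ.m + 1) → G) (hx : τ.IsReps x),
        ∃! ψ : (α.onOrbit τ).Crossed ≃⋆ₐ[ℂ] α.MatAlg τ,
          ∀ (j k : Fin (τ.m + 1)) (h : τ.stab) (a : α.tupleIdeal ((x j)⁻¹ • τ.1)),
            ψ (α.genOrbit τ hx j k h a) = α.genMat τ x j k h a) ∧
    (∀ s : Tuple.OrbitSpace G n → Tuple G n, (∀ z, (s z).orbit = z) →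
      ∀ (x : ∀ z, Fin ((s z).m + 1) → G) (hx : ∀ z, (s z).IsReps (x z)),
        ∃! Ψ : α.Crossed ≃⋆ₐ[ℂ] C0Sum fun z => α.MatAlg (s z),
          ∀ (z : Tuple.OrbitSpace G n) (j k : Fin ((s z).m + 1)) (h : (s z).stab)
            (a : α.tupleIdeal ((x z j)⁻¹ • (s z).1)),
            Ψ (α.genA (s z) (hx z) j k h a) =
              C0Sum.single (fun z => α.MatAlg (s z)) z (α.genMat (s z) (x z) j k h a)) := by
  exact ⟨fun τ => ⟨τ.exists_isReps, fun _ hx => PartialAction.existsUnique_orbitEquiv hα hx⟩,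
    fun _ hs _ hx => PartialAction.existsUnique_sumEquiv hα hs hx⟩
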